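/- **Conventions.** Let $[n]=\{1,\dots,n\}$ and $[0]=\emptyset$. An *interval partition* of a finite set $A\subset\mathbb{N}_{\ge1}$ is a partition of $A$ into non-empty, pairwise disjoint blocks, each an interval of consecutive integers; $\mathcal{I}(A)$ is the set of these (so $\mathcal{I}(\emptyset)=\{\emptyset\}$), and $\mathfrak{I}_n:=\mathcal{I}([n])$. For $I\in\mathcal{I}(A)$, the standardization $\mathrm{std}(I)\in\mathfrak{I}_{|A|}$ is obtained by transporting the blocks along the increasing bijection $A\to[|A|]$. For interval partitions $I,I'$, the gluing $I\bowtie I'$ is the set of unions of the equivalence classes of the smallest equivalence relation on the set of blocks $I\cup I'$ that relates any two intersecting blocks. Let $S_n$ be the set of permutations of $[n]$, written in one-line notation. For $\sigma\in S_n$ and $A\subset[n]$, $\mathrm{st}(\sigma|_A)\in S_{|A|}$ is the permutation with the same relative order as the subword of $\sigma$ at the positions in $A$. For $\mathfrak{s}\in\mathfrak{I}_m$, $\mathfrak{t}\in\mathfrak{I}_n$, $\sigma\in S_m$, $\tau\in S_n$, let $\mathfrak{s}\cdot\mathfrak{t}\in\mathfrak{I}_{m+n}$ consist of the blocks of $\mathfrak{s}$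 and the blocks of $\mathfrak{t}$ shifted by $m$, and let $\sigma\mathbin{\square}\tau=\sigma_1\cdots\sigma_m(\tau_1+m)\cdots(\tau_n+m)\in S_{m+n}$. Let $V=\bigoplus_{n\ge0}\mathbb{Q}[\mathfrak{I}_n\times S_n]$ be the free $\mathbb{Q}$-vector space on the pairs $(\mathfrak{s},\sigma)$, graded by the size $n$. Define (bi)linear maps on basis elements: * the concatenation product $(\mathfrak{s},\sigma)\ast(\mathfrak{t},\tau)=(\mathfrak{s}\cdot\mathfrak{t},\ \sigma\mathbin{\square}\tau)$; * its dual coproduct (deconcatenation) $\delta(\mathfrak{s},\sigma)=\sum(\mathfrak{a},\alpha)\otimes(\mathfrak{b},\beta)$, the sum running over all pairs of basis elements with $(\mathfrak{a},\alpha)\ast(\mathfrak{b},\beta)=(\mathfrak{s},\sigma)$; * for $(\mathfrak{s},\sigma)$ of size $n$, the coproduct $$\Delta(\mathfrak{s},\sigma)=\sum_{A\cup A'=[n]}\ \sum_{\substack{I\in\mathcal{I}(A),\ I'\in\mathcal{I}(A')\\ I\bowtie I'=\mathfrak{s}}}(\mathrm{std}(I),\mathrm{st}(\sigma|_A))\otimes(\mathrm{std}(I'),\mathrm{st}(\sigma|_{A'}));$$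 * its dual product $(\mathfrak{s},\sigma)\star(\mathfrak{t},\tau)=\sum_{(\mathfrak{g},\gamma)}c_{(\mathfrak{g},\gamma)}\,(\mathfrak{g},\gamma)$, where $c_{(\mathfrak{g},\gamma)}$ is the number of $(A,A',I,I')$ such that $A\cup A'=[|\gamma|]$, $I\in\mathcal{I}(A)$, $I'\in\mathcal{I}(A')$, $I\bowtie I'=\mathfrak{g}$, $\mathrm{std}(I)=\mathfrak{s}$, $\mathrm{st}(\gamma|_A)=\sigma$, $\mathrm{std}(I')=\mathfrak{t}$, $\mathrm{st}(\gamma|_{A'})=\tau$ (only finitely many coefficients are non-zero); * the unit $u:\mathbb{Q}\to V$ sending $1$ to the empty pair $e$ (the basis element of size $0$), and the counit $\varepsilon:V\to\mathbb{Q}$ taking the coefficient of $e$. **Theorem (Bialgebras on vincular permutations).** 1. $(V,\ast,\Delta,u,\varepsilon)$ is a bialgebra over $\mathbb{Q}$. 2. $(V,\star,\delta,u,\varepsilon)$ is a connected filtered Hopf algebra over $\mathbb{Q}$ for the filtration by size. That is, it is a Hopf algebra with an antipode $S$, and the subspaces $F_n$ spanned by the basis elements of size at most $n$ satisfy: $F_n\subset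 F_{n+1}$; $\bigcup_nF_n=V$; $u(1)\in F_0$; $F_p\star F_q\subset F_{p+q}$; $\delta(F_n)\subset\sum_{p+q=n}F_p\otimes F_q$; $S(F_n)\subset F_n$; and $\dim_{\mathbb{Q}}F_0=1$. -/

import Mathlib

open scoped TensorProduct

noncomputable section

namespace VincularHopf

/-! ### Interval partitions

The set `[n] = {1, …, n}` is modelled by `Fin n` (with `i : Fin n` standing for `i + 1`). -/

/-- An interval partition of a subset `A` of `[n]`: a partition of `A` (into non-empty, pairwise
disjoint blocks with union `A`) all of whose blocks are intervals of consecutive integers. -/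
structure IntervalPartition {n : ℕ} (A : Finset (Fin n)) extends Finpartition A where
  ordConnected : ∀ B ∈ parts, (B : Set (Fin n)).OrdConnected

theorem IntervalPartition.toFinpartition_injective {n : ℕ} (A : Finset (Fin n)) :
    Function.Injective (IntervalPartition.toFinpartition (A := A)) := by
  rintro ⟨P, hP⟩ ⟨Q, hQ⟩ h
  cases h
  rfl

instance {n : ℕ} (A : Finset (Fin n)) : Fintype (IntervalPartition A) :=
  Fintype.ofInjective _ (IntervalPartition.toFinpartition_injective A)

/-- Build an interval partition from the elementary description. -/
def IntervalPartition.ofBlocks {n : ℕ} {A : Finset (Fin n)} (P : Finset (Finset (Fin n)))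
    (nonempty : ∀ B ∈ P, B.Nonempty)
    (disjoint : ∀ B ∈ P, ∀ C ∈ P, ∀ i, i ∈ B → i ∈ C → B = C)
    (union : ∀ i, i ∈ A ↔ ∃ B ∈ P, i ∈ B)
    (ordConnected : ∀ B ∈ P, (B : Set (Fin n)).OrdConnected) : IntervalPartition A where
  parts := P
  supIndep := by
    rw [Finset.supIndep_iff_pairwiseDisjoint]
    intro B hB C hC hne
    refine Finset.disjoint_left.mpr fun i hi hi' => hne ?_
    exact disjoint B hB C hC i hi hi'
  sup_parts := by
    ext i
    simp [union i, Finset.mem_sup]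
  bot_notMem := fun h => by simpa using nonempty _ h
  ordConnected := ordConnected

theorem IntervalPartition.eq_of_mem {n : ℕ} {A : Finset (Fin n)} (I : IntervalPartition A)
    {B C : Finset (Fin n)} (hB : B ∈ I.parts) (hC : C ∈ I.parts) {i : Fin n}
    (hiB : i ∈ B) (hiC : i ∈ C) : B = C := by
  by_contra h
  exact Finset.disjoint_left.mp (I.disjoint hB hC h) hiB hiC

theorem IntervalPartition.mem_iff {n : ℕ} {A : Finset (Fin n)} (I : IntervalPartition A)
    (i : Fin n) : i ∈ A ↔ ∃ B ∈ I.parts, i ∈ B := by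
  conv_lhs => rw [← I.sup_parts]
  simp [Finset.mem_sup]

/-- Standardized interval partitions: the interval partitions of `[n]` itself. -/
abbrev StdIntervalPartition (n : ℕ) : Type := IntervalPartition (Finset.univ : Finset (Fin n))

/-- Standardization of an interval partition of `A`: relabel the elements of `A` by their rank,
i.e. transport the blocks along the increasing bijection between `A` and `[|A|]`. -/
def IntervalPartition.std {n : ℕ} {A : Finset (Fin n)} (I : IntervalPartition A) :
    StdIntervalPartition A.card :=
  IntervalPartition.ofBlocks
    (I.parts.image fun B => Finset.univ.filter fun i => A.orderEmbOfFin rfl i ∈ B)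
    (by
      intro C hC
      obtain ⟨B, hB, rfl⟩ := Finset.mem_image.mp hC
      obtain ⟨a, ha⟩ := I.nonempty_of_mem_parts hB
      have haA : a ∈ (A : Set (Fin n)) := I.le hB ha
      rw [← A.range_orderEmbOfFin rfl] at haA
      obtain ⟨i, rfl⟩ := haA
      exact ⟨i, by simpa using ha⟩)
    (by
      intro C hC D hD i hi hi'
      obtain ⟨B, hB, rfl⟩ := Finset.mem_image.mp hC
      obtain ⟨B', hB', rfl⟩ := Finset.mem_image.mp hD
      rw [I.eq_of_mem hB hB' (by simpa using hi) (by simpa using hi')])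
    (by
      intro i
      obtain ⟨B, hB, hi⟩ := (I.mem_iff _).mp (A.orderEmbOfFin_mem rfl i)
      simp only [Finset.mem_univ, true_iff]
      exact ⟨_, Finset.mem_image_of_mem _ hB, by simpa using hi⟩)
    (by
      intro C hC
      obtain ⟨B, hB, rfl⟩ := Finset.mem_image.mp hC
      have := (I.ordConnected B hB).preimage_mono (A.orderEmbOfFin rfl).monotone
      simpa [Set.preimage] using this)

open Classical in
/-- The blocks of the gluing of two interval partitions with sets of blocks `P` and `Q`:
take the smallest equivalence relation on `P ∪ Q` relating any two blocks that intersect, and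
form the union of each equivalence class. -/
def glue {n : ℕ} (P Q : Finset (Finset (Fin n))) : Finset (Finset (Fin n)) :=
  (P ∪ Q).image fun T =>
    ((P ∪ Q).filter fun X =>
      Relation.EqvGen (fun E F => E ∈ P ∪ Q ∧ F ∈ P ∪ Q ∧ (E ∩ F).Nonempty) T X).biUnion id

/-- Concatenation of standardized interval partitions: the blocks of `s`, together with the blocks
of `t` shifted by `m`. -/
def StdIntervalPartition.conc {m n : ℕ} (s : StdIntervalPartition m) (t : StdIntervalPartition n) :
    StdIntervalPartition (m + n) :=
  IntervalPartition.ofBlocks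
    (s.parts.image (fun B => B.map (Fin.castAddEmb n)) ∪
      t.parts.image (fun B => B.map (Fin.natAddEmb m)))
    (by
      intro C hC
      rcases Finset.mem_union.mp hC with h | h
      · obtain ⟨B, hB, rfl⟩ := Finset.mem_image.mp h
        exact (s.nonempty_of_mem_parts hB).map
      · obtain ⟨B, hB, rfl⟩ := Finset.mem_image.mp h
        exact (t.nonempty_of_mem_parts hB).map)
    (by
      intro C hC D hD i hi hi'
      rcases Finset.mem_union.mp hC with h | h <;> rcases Finset.mem_union.mp hD with h' | h' <;>
        obtain ⟨B, hB, rfl⟩ := Finset.mem_image.mp h <;>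
        obtain ⟨B', hB', rfl⟩ := Finset.mem_image.mp h' <;>
        obtain ⟨b, hb, rfl⟩ := Finset.mem_map.mp hi <;>
        obtain ⟨b', hb', hbb⟩ := Finset.mem_map.mp hi'
      · rw [(Fin.castAddEmb n).injective hbb] at hb'
        rw [s.eq_of_mem hB hB' hb hb']
      · have := congrArg Fin.val hbb
        simp at this
        omega
      · have := congrArg Fin.val hbb
        simp at this
        omega
      · rw [(Fin.natAddEmb m).injective hbb] at hb'
        rw [t.eq_of_mem hB hB' hb hb'])
    (by
      intro i
      simp only [Finset.mem_univ, true_iff]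
      refine Fin.addCases (fun j => ?_) (fun j => ?_) i
      · obtain ⟨B, hB, hj⟩ := (s.mem_iff j).mp (Finset.mem_univ j)
        exact ⟨_, Finset.mem_union_left _ (Finset.mem_image_of_mem _ hB),
          Finset.mem_map_of_mem (Fin.castAddEmb n) hj⟩
      · obtain ⟨B, hB, hj⟩ := (t.mem_iff j).mp (Finset.mem_univ j)
        exact ⟨_, Finset.mem_union_right _ (Finset.mem_image_of_mem _ hB),
          Finset.mem_map_of_mem (Fin.natAddEmb m) hj⟩)
    (by
      intro C hC
      rcases Finset.mem_union.mp hC with h | h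
      · obtain ⟨B, hB, rfl⟩ := Finset.mem_image.mp h
        refine ⟨fun x hx y hy z hz => ?_⟩
        obtain ⟨x, hxB, rfl⟩ := Finset.mem_map.mp (Finset.mem_coe.mp hx)
        obtain ⟨y, hyB, rfl⟩ := Finset.mem_map.mp (Finset.mem_coe.mp hy)
        have h2 := Fin.le_def.mp hz.2
        simp at h2
        have hzm : (z : ℕ) < m := by omega
        have hzB := (s.ordConnected B hB).out hxB hyB
          (show (⟨z, hzm⟩ : Fin m) ∈ Set.Icc x y from ⟨hz.1, hz.2⟩)
        exact Finset.mem_coe.mpr (Finset.mem_map.mpr ⟨_, hzB, rfl⟩)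
      · obtain ⟨B, hB, rfl⟩ := Finset.mem_image.mp h
        refine ⟨fun x hx y hy z hz => ?_⟩
        obtain ⟨x, hxB, rfl⟩ := Finset.mem_map.mp (Finset.mem_coe.mp hx)
        obtain ⟨y, hyB, rfl⟩ := Finset.mem_map.mp (Finset.mem_coe.mp hy)
        have h1 := Fin.le_def.mp hz.1
        have h2 := Fin.le_def.mp hz.2
        simp at h1 h2
        have hzB := (t.ordConnected B hB).out hxB hyB
          (show (⟨z - m, by omega⟩ : Fin n) ∈ Set.Icc x y from
            ⟨Fin.le_def.mpr (by simp; omega), Fin.le_def.mpr (by simp; omega)⟩)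
        refine Finset.mem_coe.mpr (Finset.mem_map.mpr ⟨_, hzB, ?_⟩)
        ext
        simp
        omega)

/-! ### Permutations, in one-line notation `σ(1) σ(2) … σ(n)` -/

/-- The pattern `st(σ|_A)` of `σ` at the set of positions `A`: the permutation of `[|A|]` whose
one-line notation has the same relative order as the subword of `σ` at the positions in `A`. -/
def restrictPerm {n : ℕ} (σ : Equiv.Perm (Fin n)) (A : Finset (Fin n)) :
    Equiv.Perm (Fin A.card) :=
  (A.orderIsoOfFin rfl).toEquiv.trans <|
    (σ.subtypeEquiv (fun a => by simp) : A ≃ (A.map σ.toEmbedding : Finset (Fin n))).trans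
      ((A.map σ.toEmbedding).orderIsoOfFin (Finset.card_map _)).toEquiv.symm

/-- The concatenation `σ(1) … σ(m) (τ(1) + m) … (τ(n) + m)` of two permutations. -/
def concPerm {m n : ℕ} (σ : Equiv.Perm (Fin m)) (τ : Equiv.Perm (Fin n)) :
    Equiv.Perm (Fin (m + n)) :=
  finSumFinEquiv.permCongr (Equiv.Perm.sumCongr σ τ)

/-! ### Vincular permutations -/

/-- A vincular permutation: an interval partition of `[n]` together with a permutation of `[n]`. -/
@[ext]
structure VincPerm where
  size : ℕ
  part : StdIntervalPartition size
  perm : Equiv.Perm (Fin size)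

namespace VincPerm

/-- The empty vincular permutation (the only one of size `0`). -/
def empty : VincPerm where
  size := 0
  part := IntervalPartition.ofBlocks ∅ (by simp) (by simp) (fun i => i.elim0) (by simp)
  perm := 1

/-- `(s, σ) · (t, τ) = (s · t, σ · τ)`, concatenating both components. -/
def conc (x y : VincPerm) : VincPerm where
  size := x.size + y.size
  part := StdIntervalPartition.conc x.part y.part
  perm := concPerm x.perm y.perm

/-- The vincular permutation `(std(I), st(σ|_A))` attached to an interval partition `I` of a
subset `A` of `[n]` and a permutation `σ` of `[n]`. -/
def restrict {n : ℕ} (σ : Equiv.Perm (Fin n)) {A : Finset (Fin n)} (I : IntervalPartition A) :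
    VincPerm where
  size := A.card
  part := I.std
  perm := restrictPerm σ A

theorem finite_size_le (N : ℕ) : {x : VincPerm | x.size ≤ N}.Finite := by
  refine (Set.finite_range
    (fun p : (Σ k : Fin (N + 1), StdIntervalPartition k × Equiv.Perm (Fin k)) =>
      (⟨p.1, p.2.1, p.2.2⟩ : VincPerm))).subset ?_
  rintro ⟨k, s, σ⟩ hk
  exact ⟨⟨⟨k, Nat.lt_succ_of_le hk⟩, s, σ⟩, rfl⟩

theorem finite_conc_eq (z : VincPerm) : {p : VincPerm × VincPerm | p.1.conc p.2 = z}.Finite := by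
  refine ((finite_size_le z.size).prod (finite_size_le z.size)).subset ?_
  rintro ⟨x, y⟩ rfl
  exact ⟨Nat.le_add_right _ _, Nat.le_add_left _ _⟩

end VincPerm

/-- The free `ℚ`-vector space on vincular permutations. -/
abbrev FreeVincPerm : Type := VincPerm →₀ ℚ

/-- The basis vector attached to a vincular permutation. -/
abbrev basisVec (x : VincPerm) : FreeVincPerm := Finsupp.single x 1

/-- The product extending concatenation of vincular permutations bilinearly. -/
def mulConc : FreeVincPerm →ₗ[ℚ] FreeVincPerm →ₗ[ℚ] FreeVincPerm :=
  Finsupp.linearCombination ℚ fun x =>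
    Finsupp.linearCombination ℚ fun y => basisVec (x.conc y)

/-- The coproduct dual to concatenation: `z ↦ ∑_{x · y = z} x ⊗ y`. -/
def comulDeconc : FreeVincPerm →ₗ[ℚ] FreeVincPerm ⊗[ℚ] FreeVincPerm :=
  Finsupp.linearCombination ℚ fun z =>
    ∑ p ∈ z.finite_conc_eq.toFinset, basisVec p.1 ⊗ₜ[ℚ] basisVec p.2

open Classical in
/-- The coproduct combining the gluing of interval partitions with restriction of permutations:
`(s, σ) ↦ ∑ (std(I), st(σ|_A)) ⊗ (std(I'), st(σ|_{A'}))`, the sum running over all `A, A'` with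
`A ∪ A' = [n]` and all interval partitions `I` of `A` and `I'` of `A'` whose gluing is `s`. -/
def comulGlue : FreeVincPerm →ₗ[ℚ] FreeVincPerm ⊗[ℚ] FreeVincPerm :=
  Finsupp.linearCombination ℚ fun z =>
    ∑ A : Finset (Fin z.size), ∑ A' : Finset (Fin z.size),
      if A ∪ A' = Finset.univ then
        ∑ I : IntervalPartition A, ∑ I' : IntervalPartition A',
          if glue I.parts I'.parts = z.part.parts then
            basisVec (VincPerm.restrict z.perm I) ⊗ₜ[ℚ] basisVec (VincPerm.restrict z.perm I')
          else 0
      else 0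

open Classical in
/-- The multiplicity of `z = (g, γ)` in the product of `x = (s, σ)` and `y = (t, τ)`: the number of
`(A, A', I, I')` with `A ∪ A' = [|z|]`, where `I`, `I'` are interval partitions of `A`, `A'` with
gluing `g`, such that `std(I) = s`, `st(γ|_A) = σ`, `std(I') = t` and `st(γ|_{A'}) = τ`. -/
def glueCoeff (x y z : VincPerm) : ℚ :=
  ∑ A : Finset (Fin z.size), ∑ A' : Finset (Fin z.size),
    if A ∪ A' = Finset.univ then
      ∑ I : IntervalPartition A, ∑ I' : IntervalPartition A',
        if glue I.parts I'.parts = z.part.parts ∧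
          VincPerm.restrict z.perm I = x ∧ VincPerm.restrict z.perm I' = y then 1 else 0
    else 0

theorem finite_support_glueCoeff (x y : VincPerm) : (Function.support (glueCoeff x y)).Finite := by
  refine (VincPerm.finite_size_le (x.size + y.size)).subset fun z hz => ?_
  by_contra hlt
  simp only [Set.mem_ofPred_eq, not_le] at hlt
  refine hz ?_
  refine Finset.sum_eq_zero fun A _ => Finset.sum_eq_zero fun A' _ => ?_
  split_ifs with hA
  · refine Finset.sum_eq_zero fun I _ => Finset.sum_eq_zero fun I' _ => if_neg ?_
    rintro ⟨-, rfl, rfl⟩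
    have h := Finset.card_union_le A A'
    rw [hA, Finset.card_univ, Fintype.card_fin] at h
    exact absurd hlt (not_lt.mpr h)
  · rfl

/-- The product dual to `comulGlue`: `x * y = ∑_z glueCoeff x y z • z` (a finite sum). -/
def mulGlue : FreeVincPerm →ₗ[ℚ] FreeVincPerm →ₗ[ℚ] FreeVincPerm :=
  Finsupp.linearCombination ℚ fun x =>
    Finsupp.linearCombination ℚ fun y =>
      Finsupp.ofSupportFinite (glueCoeff x y) (finite_support_glueCoeff x y)

/-- The unit map, `1 ↦` the empty vincular permutation. -/
def unitMap : ℚ →ₗ[ℚ] FreeVincPerm := Finsupp.lsingle VincPerm.empty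

/-- The counit map, taking the coefficient of the empty vincular permutation. -/
def counitMap : FreeVincPerm →ₗ[ℚ] ℚ := Finsupp.lapply VincPerm.empty

/-- The increasing filtration coming from the grading by size: its `n`-th term is spanned by the
vincular permutations of size at most `n`. -/
def sizeFiltration (n : ℕ) : Submodule ℚ FreeVincPerm :=
  Submodule.span ℚ {v | ∃ x : VincPerm, x.size ≤ n ∧ v = basisVec x}

/-! ### Bialgebras and Hopf algebras given by structure maps on a fixed vector space -/

section Structures

universe u v

variable {K : Type u} [Field K] {V : Type v} [AddCommGroup V] [Module K V]

/-- `(V, mul, comul, unit, counit)` is a bialgebra over `K`: these maps are, up to a linear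
isomorphism of the carrier (for instance onto a type synonym of `V`), the structure maps of a
bialgebra. -/
def IsBialgebra (mul : V →ₗ[K] V →ₗ[K] V) (comul : V →ₗ[K] V ⊗[K] V)
    (unit : K →ₗ[K] V) (counit : V →ₗ[K] K) : Prop :=
  ∃ (H : Type v) (_ : Ring H) (_ : Bialgebra K H) (e : V ≃ₗ[K] H),
    (∀ x y, e (mul x y) = e x * e y) ∧
    (∀ c, e (unit c) = algebraMap K H c) ∧
    (∀ x, Coalgebra.comul (R := K) (e x) =
      TensorProduct.map e.toLinearMap e.toLinearMap (comul x)) ∧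
    (∀ x, Coalgebra.counit (R := K) (e x) = counit x)

/-- `(V, mul, comul, unit, counit)` is a Hopf algebra over `K` with antipode `S`. -/
def IsHopfAlgebra (mul : V →ₗ[K] V →ₗ[K] V) (comul : V →ₗ[K] V ⊗[K] V)
    (unit : K →ₗ[K] V) (counit : V →ₗ[K] K) (S : V →ₗ[K] V) : Prop :=
  ∃ (H : Type v) (_ : Ring H) (_ : HopfAlgebra K H) (e : V ≃ₗ[K] H),
    (∀ x y, e (mul x y) = e x * e y) ∧
    (∀ c, e (unit c) = algebraMap K H c) ∧
    (∀ x, Coalgebra.comul (R := K) (e x) =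
      TensorProduct.map e.toLinearMap e.toLinearMap (comul x)) ∧
    (∀ x, Coalgebra.counit (R := K) (e x) = counit x) ∧
    (∀ x, HopfAlgebra.antipode K (e x) = e (S x))

/-- `F` is an increasing exhaustive filtration of `V` compatible with the product, the coproduct,
the unit and the antipode `S`, and it is connected: `F 0` is one-dimensional. -/
structure IsConnectedHopfFiltration (mul : V →ₗ[K] V →ₗ[K] V) (comul : V →ₗ[K] V ⊗[K] V)
    (unit : K →ₗ[K] V) (S : V →ₗ[K] V) (F : ℕ → Submodule K V) : Prop where
  mono : Monotone F
  exhaustive : ⨆ n, F n = ⊤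
  unit_mem : unit 1 ∈ F 0
  mul_mem : ∀ p q, ∀ x ∈ F p, ∀ y ∈ F q, mul x y ∈ F (p + q)
  comul_mem : ∀ n, ∀ x ∈ F n, comul x ∈
    ⨆ (p : ℕ) (q : ℕ) (_ : p + q = n),
      LinearMap.range (TensorProduct.map (F p).subtype (F q).subtype)
  antipode_mem : ∀ n, ∀ x ∈ F n, S x ∈ F n
  connected : Module.finrank K (F 0) = 1

/-- `(V, mul, comul, unit, counit)` with the filtration `F` is a connected filtered Hopf algebra
over `K`. -/
def IsConnectedFilteredHopfAlgebra (mul : V →ₗ[K] V →ₗ[K] V) (comul : V →ₗ[K] V ⊗[K] V)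
    (unit : K →ₗ[K] V) (counit : V →ₗ[K] K) (F : ℕ → Submodule K V) : Prop :=
  ∃ S : V →ₗ[K] V, IsHopfAlgebra mul comul unit counit S ∧
    IsConnectedHopfFiltration mul comul unit S F

end Structures

end VincularHopf

end

noncomputable section

namespace VincularHopf

/-! ### Interval partitions as subgraphs of a path -/

/-! An interval partition of a subset `A` of `[n]` is the same thing as a subgraph of the path on
`[n]`: the vertices are the elements of `A`, the edges are the pairs `i, i + 1` in a common block,
and the blocks are the connected components. The `cellsOf` encoding records vertices and edges as
one finite set of pairs. Under it gluing is simply union of subgraphs (`glue_eq_iff`), so the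
coproduct of `z` is a sum over ordered pairs of subgraphs whose union is the graph of `z`, each
summand carrying two standardized restrictions of `z` (`comulGlue_basisVec`).

Seen this way the bialgebra axioms are elementary. Both iterated coproducts run over triples of
subgraphs with a given union (`sum_coverings_assoc`), because restricting in two stages is the same
as restricting once (`sum_coverings_res`). The counit keeps only the covering in which one subgraph
is empty. No edge joins the two factors of a concatenation, so a covering of the concatenation is a
pair of coverings, one for each factor (`sum_coverings_conc`); this is multiplicativity of the
coproduct.

The second structure is the adjoint of the first for the pairing that makes the basis orthonormal,
and the axioms are carried across by `BialgebraAxioms.dual`. The antipode is obtained by recursion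
on size: deconcatenation has a single term with empty right factor and a single term with empty left
factor, which allows left and right convolution inverses of the identity to be solved for
separately, and the two must then agree. The filtration bounds follow from `|A ∪ A'| ≤ |A| + |A'|`
and the same recursion. -/

/-- Two positions lie in a common block. -/
def SameBlock {n : ℕ} (P : Finset (Finset (Fin n))) (i j : Fin n) : Prop :=
  ∃ B ∈ P, i ∈ B ∧ j ∈ B

open Classical in
/-- The cells of a family of blocks: the pairs `(i, i)` and `(i, i + 1)` contained in a block.
They are the vertices and edges of a subgraph of the path on `[n]`. -/
def cellsOf {n : ℕ} (P : Finset (Finset (Fin n))) : Finset (Fin n × Fin n) :=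
  Finset.univ.filter fun p => p.1 ≤ p.2 ∧ (p.2 : ℕ) ≤ p.1 + 1 ∧ SameBlock P p.1 p.2

/-- A set of cells which is a subgraph of the path on `[n]`. -/
structure IsSubpath {n : ℕ} (S : Finset (Fin n × Fin n)) : Prop where
  le : ∀ i j, (i, j) ∈ S → i ≤ j
  adj : ∀ i j, (i, j) ∈ S → (j : ℕ) ≤ i + 1
  left : ∀ i j, (i, j) ∈ S → (i, i) ∈ S
  right : ∀ i j, (i, j) ∈ S → (j, j) ∈ S

theorem mem_cellsOf {n : ℕ} {P : Finset (Finset (Fin n))} {i j : Fin n} :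
    (i, j) ∈ cellsOf P ↔ i ≤ j ∧ (j : ℕ) ≤ i + 1 ∧ SameBlock P i j := by
  simp [cellsOf]

theorem isSubpath_cellsOf {n : ℕ} (P : Finset (Finset (Fin n))) : IsSubpath (cellsOf P) where
  le i j h := (mem_cellsOf.mp h).1
  adj i j h := (mem_cellsOf.mp h).2.1
  left i j h := by
    obtain ⟨-, -, B, hB, hi, hj⟩ := mem_cellsOf.mp h
    exact mem_cellsOf.mpr ⟨le_rfl, by omega, B, hB, hi, hi⟩
  right i j h := by
    obtain ⟨-, -, B, hB, hi, hj⟩ := mem_cellsOf.mp h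
    exact mem_cellsOf.mpr ⟨le_rfl, by omega, B, hB, hj, hj⟩

theorem mem_cellsOf_self {n : ℕ} {P : Finset (Finset (Fin n))} {i : Fin n} :
    (i, i) ∈ cellsOf P ↔ ∃ B ∈ P, i ∈ B := by
  simp [mem_cellsOf, SameBlock]

namespace IntervalPartition

variable {n : ℕ} {A A' : Finset (Fin n)}

theorem mem_iff_cells (I : IntervalPartition A) (i : Fin n) :
    i ∈ A ↔ (i, i) ∈ cellsOf I.parts := by
  rw [mem_cellsOf_self, I.mem_iff]

theorem sameBlock_trans (I : IntervalPartition A) {i j k : Fin n}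
    (h : SameBlock I.parts i j) (h' : SameBlock I.parts j k) : SameBlock I.parts i k := by
  obtain ⟨B, hB, hi, hj⟩ := h
  obtain ⟨C, hC, hj', hk⟩ := h'
  obtain rfl := I.eq_of_mem hB hC hj hj'
  exact ⟨B, hB, hi, hk⟩

/-- Induction on the distance `d`: a block of `P` containing `i` and `j` is an interval, so it
contains `i + 1`; the edge from `i` to `i + 1` is then a cell of `I`, and being in a common block is
transitive in `I`. The family `P` need not be disjoint, which permits its use for the union of two
partitions. -/
theorem sameBlock_of_cells_le {P : Finset (Finset (Fin n))} (I : IntervalPartition A)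
    (hP : ∀ B ∈ P, (B : Set (Fin n)).OrdConnected) (h : cellsOf P ⊆ cellsOf I.parts) :
    ∀ (d : ℕ) (i j : Fin n), (j : ℕ) = i + d → SameBlock P i j → SameBlock I.parts i j := by
  intro d
  induction d with
  | zero =>
    intro i j hij ⟨B, hB, hi, hj⟩
    obtain rfl : j = i := Fin.ext (by simpa using hij)
    exact (mem_cellsOf.mp (h (mem_cellsOf_self.mpr ⟨B, hB, hi⟩))).2.2
  | succ d ih =>
    intro i j hij ⟨B, hB, hi, hj⟩
    let k : Fin n := ⟨i + 1, by omega⟩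
    have hk : k ∈ B := (hP B hB).out hi hj
      ⟨Fin.le_def.mpr (by simp [k]), Fin.le_def.mpr (by simp [k]; omega)⟩
    refine I.sameBlock_trans (j := k) ?_ (ih k j (by simp [k]; omega) ⟨B, hB, hk, hj⟩)
    exact (mem_cellsOf.mp (h (mem_cellsOf.mpr
      ⟨Fin.le_def.mpr (by simp [k]), by simp [k], B, hB, hi, hk⟩))).2.2

theorem sameBlock_mono {P : Finset (Finset (Fin n))} (I : IntervalPartition A)
    (hP : ∀ B ∈ P, (B : Set (Fin n)).OrdConnected) (h : cellsOf P ⊆ cellsOf I.parts)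
    {i j : Fin n} (hij : SameBlock P i j) : SameBlock I.parts i j := by
  rcases le_total i j with hle | hle
  · exact I.sameBlock_of_cells_le hP h (j - i) i j (by have := Fin.le_def.mp hle; omega) hij
  · obtain ⟨B, hB, hi, hj⟩ := hij
    obtain ⟨C, hC, hj', hi'⟩ := I.sameBlock_of_cells_le hP h (i - j) j i
      (by have := Fin.le_def.mp hle; omega) ⟨B, hB, hj, hi⟩
    exact ⟨C, hC, hi', hj'⟩

/-- A block is the set of all positions sharing a block with any one of its elements, and that
relation is determined by the cells. -/
theorem parts_subset_of_cells_eq (I : IntervalPartition A) (I' : IntervalPartition A')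
    (h : cellsOf I.parts = cellsOf I'.parts) : I.parts ⊆ I'.parts := by
  intro B hB
  obtain ⟨a, ha⟩ := I.nonempty_of_mem_parts hB
  have : (a, a) ∈ cellsOf I'.parts := h ▸ mem_cellsOf_self.mpr ⟨B, hB, ha⟩
  obtain ⟨B', hB', ha'⟩ := mem_cellsOf_self.mp this
  convert hB'
  ext b
  constructor
  · intro hb
    obtain ⟨C, hC, haC, hbC⟩ := I'.sameBlock_mono I.ordConnected h.le ⟨B, hB, ha, hb⟩
    rwa [I'.eq_of_mem hB' hC ha' haC]
  · intro hb
    obtain ⟨C, hC, haC, hbC⟩ := I.sameBlock_mono I'.ordConnected h.ge ⟨B', hB', ha', hb⟩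
    rwa [I.eq_of_mem hB hC ha haC]

theorem parts_eq_of_cells_eq (I : IntervalPartition A) (I' : IntervalPartition A')
    (h : cellsOf I.parts = cellsOf I'.parts) : I.parts = I'.parts :=
  (I.parts_subset_of_cells_eq I' h).antisymm (I'.parts_subset_of_cells_eq I h.symm)

theorem ext_parts {I I' : IntervalPartition A} (h : I.parts = I'.parts) : I = I' :=
  toFinpartition_injective A (Finpartition.ext h)

theorem eq_of_cells_eq {I I' : IntervalPartition A}
    (h : cellsOf I.parts = cellsOf I'.parts) : I = I' :=
  ext_parts (parts_eq_of_cells_eq I I' h)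

/-- The diagonal cells recover the underlying set, so cells encode the set together with its
partition; this is the injectivity needed to reindex sums over both. -/
theorem sigma_eq_of_cells_eq (I : IntervalPartition A) (I' : IntervalPartition A')
    (h : cellsOf I.parts = cellsOf I'.parts) :
    (⟨A, I⟩ : Σ A : Finset (Fin n), IntervalPartition A) = ⟨A', I'⟩ := by
  obtain rfl : A = A' := by
    ext i
    rw [I.mem_iff_cells, I'.mem_iff_cells, h]
  rw [eq_of_cells_eq h]

end IntervalPartition

/-! ### The interval partition with a given set of cells -/

section OfCells

variable {n : ℕ}

/-- The vertices of a set of cells. -/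
def verts (S : Finset (Fin n × Fin n)) : Finset (Fin n) :=
  Finset.univ.filter fun i => (i, i) ∈ S

theorem mem_verts {S : Finset (Fin n × Fin n)} {i : Fin n} : i ∈ verts S ↔ (i, i) ∈ S := by
  simp [verts]

/-- All edges between `i` and `j` belong to `S`. -/
def Linked (S : Finset (Fin n × Fin n)) (i j : Fin n) : Prop :=
  ∀ k l : Fin n, (l : ℕ) = k + 1 → min (i : ℕ) j ≤ k → (k : ℕ) < max (i : ℕ) j → (k, l) ∈ S

theorem Linked.refl (S : Finset (Fin n × Fin n)) (i : Fin n) : Linked S i i := by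
  intro k l _ h h'
  simp at h h'
  omega

theorem Linked.symm {S : Finset (Fin n × Fin n)} {i j : Fin n} (h : Linked S i j) :
    Linked S j i := by
  intro k l hkl h1 h2
  exact h k l hkl (by omega) (by omega)

theorem Linked.trans {S : Finset (Fin n × Fin n)} {i j k : Fin n} (h : Linked S i j)
    (h' : Linked S j k) : Linked S i k := by
  intro a b hab h1 h2
  by_cases hc : min (i : ℕ) j ≤ a ∧ (a : ℕ) < max (i : ℕ) j
  · exact h a b hab hc.1 hc.2
  · exact h' a b hab (by omega) (by omega)

open Classical in
/-- The block of `i` in the interval partition with cells `S`. -/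
def linkedBlock (S : Finset (Fin n × Fin n)) (i : Fin n) : Finset (Fin n) :=
  (verts S).filter fun j => Linked S i j

theorem mem_linkedBlock {S : Finset (Fin n × Fin n)} {i j : Fin n} :
    j ∈ linkedBlock S i ↔ (j, j) ∈ S ∧ Linked S i j := by
  simp [linkedBlock, mem_verts]

theorem linkedBlock_congr {S : Finset (Fin n × Fin n)} {i j : Fin n} (h : Linked S i j) :
    linkedBlock S i = linkedBlock S j := by
  ext k
  simp only [mem_linkedBlock]
  exact and_congr_right fun _ => ⟨h.symm.trans, h.trans⟩

/-- The interval partition with a given set of cells. -/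
def ofCells (S : Finset (Fin n × Fin n)) (hS : IsSubpath S) : IntervalPartition (verts S) :=
  IntervalPartition.ofBlocks ((verts S).image (linkedBlock S))
    (by
      intro B hB
      obtain ⟨i, hi, rfl⟩ := Finset.mem_image.mp hB
      exact ⟨i, mem_linkedBlock.mpr ⟨mem_verts.mp hi, .refl _ _⟩⟩)
    (by
      intro B hB C hC k hk hk'
      obtain ⟨i, hi, rfl⟩ := Finset.mem_image.mp hB
      obtain ⟨j, hj, rfl⟩ := Finset.mem_image.mp hC
      exact linkedBlock_congr ((mem_linkedBlock.mp hk).2.trans (mem_linkedBlock.mp hk').2.symm))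
    (by
      intro i
      constructor
      · exact fun hi => ⟨_, Finset.mem_image_of_mem _ hi,
          mem_linkedBlock.mpr ⟨mem_verts.mp hi, .refl _ _⟩⟩
      · rintro ⟨B, hB, hi⟩
        obtain ⟨j, hj, rfl⟩ := Finset.mem_image.mp hB
        exact mem_verts.mpr (mem_linkedBlock.mp hi).1)
    (by
      intro B hB
      obtain ⟨i, hi, rfl⟩ := Finset.mem_image.mp hB
      refine ⟨fun x hx y hy z hz => ?_⟩
      obtain ⟨hxS, hx⟩ := mem_linkedBlock.mp (Finset.mem_coe.mp hx)
      obtain ⟨hyS, hy⟩ := mem_linkedBlock.mp (Finset.mem_coe.mp hy)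
      have h1 := Fin.le_def.mp hz.1
      have h2 := Fin.le_def.mp hz.2
      have hxy := hx.symm.trans hy
      have hxz : Linked S x z := fun k l hkl h3 h4 => hxy k l hkl (by omega) (by omega)
      refine Finset.mem_coe.mpr (mem_linkedBlock.mpr ⟨?_, hx.trans hxz⟩)
      rcases h1.eq_or_lt with h | h
      · rwa [← Fin.ext h]
      -- Here `x < z`, so the edge from `z - 1` to `z` belongs to `S`, and its right endpoint is a
      -- vertex.
      · exact hS.right ⟨z - 1, by omega⟩ z (hxy _ _ (by simp; omega) (by simp; omega)
          (by simp; omega)))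

/-- For neighbours `i` and `i + 1`, being linked means exactly that the single edge between them is
present. With `eq_of_cells_eq` this makes subgraphs and interval partitions equivalent data. -/
theorem cellsOf_ofCells (S : Finset (Fin n × Fin n)) (hS : IsSubpath S) :
    cellsOf (ofCells S hS).parts = S := by
  ext ⟨i, j⟩
  rw [mem_cellsOf]
  constructor
  · rintro ⟨hle, hadj, B, hB, hi, hj⟩
    obtain ⟨a, ha, rfl⟩ := Finset.mem_image.mp hB
    obtain ⟨hiS, hi⟩ := mem_linkedBlock.mp hi
    obtain ⟨hjS, hj⟩ := mem_linkedBlock.mp hj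
    have hle' := Fin.le_def.mp hle
    rcases hle'.eq_or_lt with h | h
    · rwa [← Fin.ext h]
    · exact (hi.symm.trans hj) i j (by omega) (by omega) (by omega)
  · intro h
    have hle := Fin.le_def.mp (hS.le i j h)
    have hadj := hS.adj i j h
    have hi := hS.left i j h
    refine ⟨hS.le i j h, hadj, linkedBlock S i, Finset.mem_image_of_mem _ (mem_verts.mpr hi),
      mem_linkedBlock.mpr ⟨hi, .refl _ _⟩, mem_linkedBlock.mpr ⟨hS.right i j h, ?_⟩⟩
    intro k l hkl h1 h2
    obtain rfl : i = k := Fin.ext (by omega)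
    obtain rfl : j = l := Fin.ext (by omega)
    exact h

end OfCells

/-! ### Gluing is the union of sets of cells -/

section Glue

variable {n : ℕ}

theorem cellsOf_union (P Q : Finset (Finset (Fin n))) :
    cellsOf (P ∪ Q) = cellsOf P ∪ cellsOf Q := by
  ext ⟨i, j⟩
  simp only [Finset.mem_union, mem_cellsOf, SameBlock]
  grind

/-- The relation generating the gluing of a family of blocks. -/
abbrev BlocksMeet (U : Finset (Finset (Fin n))) (E F : Finset (Fin n)) : Prop :=
  E ∈ U ∧ F ∈ U ∧ (E ∩ F).Nonempty

theorem mem_glue {P Q : Finset (Finset (Fin n))} {Z : Finset (Fin n)} :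
    Z ∈ glue P Q ↔ ∃ T ∈ P ∪ Q, ∀ b, b ∈ Z ↔
      ∃ X ∈ P ∪ Q, Relation.EqvGen (BlocksMeet (P ∪ Q)) T X ∧ b ∈ X := by
  unfold glue
  rw [Finset.mem_image]
  refine exists_congr fun T => and_congr_right fun _ => ?_
  rw [Finset.ext_iff]
  refine forall_congr' fun b => ?_
  simp only [Finset.mem_biUnion, Finset.mem_filter, id, and_assoc]
  exact Iff.comm

/-- Walk from `i` to `j` inside one block of `I`. Each step is an edge, hence lies in some block `W`
of `U`, and `W` meets the block reached so far. -/
theorem eqvGen_of_cells {U : Finset (Finset (Fin n))} {A : Finset (Fin n)}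
    (I : IntervalPartition A) (h : cellsOf U = cellsOf I.parts) :
    ∀ (d : ℕ) (i j : Fin n), (j : ℕ) = i + d → SameBlock I.parts i j →
      ∀ X ∈ U, ∀ Y ∈ U, i ∈ X → j ∈ Y → Relation.EqvGen (BlocksMeet U) X Y := by
  intro d
  induction d with
  | zero =>
    intro i j hij _ X hX Y hY hi hj
    obtain rfl : j = i := Fin.ext (by simpa using hij)
    exact .rel _ _ ⟨hX, hY, j, Finset.mem_inter.mpr ⟨hi, hj⟩⟩
  | succ d ih =>
    intro i j hij ⟨B, hB, hiB, hjB⟩ X hX Y hY hi hj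
    let k : Fin n := ⟨i + 1, by omega⟩
    have hk : k ∈ B := (I.ordConnected B hB).out hiB hjB
      ⟨Fin.le_def.mpr (by simp [k]), Fin.le_def.mpr (by simp [k]; omega)⟩
    have : (i, k) ∈ cellsOf U := h ▸ mem_cellsOf.mpr
      ⟨Fin.le_def.mpr (by simp [k]), by simp [k], B, hB, hiB, hk⟩
    obtain ⟨-, -, W, hW, hiW, hkW⟩ := mem_cellsOf.mp this
    exact .trans _ W _ (.rel _ _ ⟨hX, hW, i, Finset.mem_inter.mpr ⟨hi, hiW⟩⟩)
      (ih k j (by simp [k]; omega) ⟨B, hB, hk, hjB⟩ W hW Y hY hkW hj)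

/-- A member of `P ∪ Q` meeting a block `Z` of `I` is contained in `Z`, so an equivalence class
never leaves `Z`. Conversely `eqvGen_of_cells` connects all members lying in `Z`, and they cover
`Z`. -/
theorem glue_eq_of_cells {P Q : Finset (Finset (Fin n))} {A : Finset (Fin n)}
    (I : IntervalPartition A) (hne : ∀ B ∈ P ∪ Q, B.Nonempty)
    (hoc : ∀ B ∈ P ∪ Q, (B : Set (Fin n)).OrdConnected)
    (h : cellsOf (P ∪ Q) = cellsOf I.parts) : glue P Q = I.parts := by
  have hsub : ∀ E ∈ P ∪ Q, ∀ Z ∈ I.parts, ∀ a ∈ E, a ∈ Z → E ⊆ Z := by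
    intro E hE Z hZ a ha haZ b hb
    obtain ⟨C, hC, haC, hbC⟩ := I.sameBlock_mono hoc h.le ⟨E, hE, ha, hb⟩
    rwa [I.eq_of_mem hZ hC haZ haC]
  -- Containment in a fixed `Z` is invariant under the generating relation, hence constant on
  -- classes.
  have hcls : ∀ T X, Relation.EqvGen (BlocksMeet (P ∪ Q)) T X → ∀ Z ∈ I.parts,
      (T ⊆ Z ↔ X ⊆ Z) := by
    intro T X hTX Z hZ
    induction hTX with
    | rel E F hEF =>
      obtain ⟨hE, hF, a, ha⟩ := hEF
      obtain ⟨haE, haF⟩ := Finset.mem_inter.mp ha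
      exact ⟨fun hs => hsub F hF Z hZ a haF (hs haE), fun hs => hsub E hE Z hZ a haE (hs haF)⟩
    | refl => exact Iff.rfl
    | symm _ _ _ ih => exact ih.symm
    | trans _ _ _ _ _ ih ih' => exact ih.trans ih'
  have key : ∀ T ∈ P ∪ Q, ∀ Z ∈ I.parts, ∀ a ∈ T, a ∈ Z → ∀ b, b ∈ Z ↔
      ∃ X ∈ P ∪ Q, Relation.EqvGen (BlocksMeet (P ∪ Q)) T X ∧ b ∈ X := by
    intro T hT Z hZ a haT haZ b
    constructor
    · intro hb
      have : (b, b) ∈ cellsOf (P ∪ Q) := h ▸ mem_cellsOf_self.mpr ⟨Z, hZ, hb⟩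
      obtain ⟨X, hX, hbX⟩ := mem_cellsOf_self.mp this
      refine ⟨X, hX, ?_, hbX⟩
      rcases le_total a b with hab | hab
      · exact eqvGen_of_cells I h (b - a) a b (by have := Fin.le_def.mp hab; omega)
          ⟨Z, hZ, haZ, hb⟩ T hT X hX haT hbX
      · exact (eqvGen_of_cells I h (a - b) b a (by have := Fin.le_def.mp hab; omega)
          ⟨Z, hZ, hb, haZ⟩ X hX T hT hbX haT).symm
    · rintro ⟨X, hX, hTX, hbX⟩
      exact (hcls T X hTX Z hZ).mp (hsub T hT Z hZ a haT haZ) hbX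
  ext Z
  rw [mem_glue]
  constructor
  · rintro ⟨T, hT, hZ⟩
    obtain ⟨a, ha⟩ := hne T hT
    have : (a, a) ∈ cellsOf I.parts := h ▸ mem_cellsOf_self.mpr ⟨T, hT, ha⟩
    obtain ⟨Z', hZ', haZ'⟩ := mem_cellsOf_self.mp this
    convert hZ'
    ext b
    rw [hZ, key T hT Z' hZ' a ha haZ']
  · intro hZ
    obtain ⟨a, ha⟩ := I.nonempty_of_mem_parts hZ
    have : (a, a) ∈ cellsOf (P ∪ Q) := h ▸ mem_cellsOf_self.mpr ⟨Z, hZ, ha⟩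
    obtain ⟨T, hT, haT⟩ := mem_cellsOf_self.mp this
    exact ⟨T, hT, key T hT Z hZ a haT ha⟩

/-- Gluing creates no new edge: if no original block contains both `i` and its neighbour, every
block lies on one side of the gap after `i`, and intersecting blocks lie on the same side. -/
theorem cellsOf_glue {P Q : Finset (Finset (Fin n))}
    (hoc : ∀ B ∈ P ∪ Q, (B : Set (Fin n)).OrdConnected) :
    cellsOf (glue P Q) = cellsOf (P ∪ Q) := by
  ext ⟨i, j⟩
  rw [mem_cellsOf, mem_cellsOf]
  refine and_congr_right fun hle => and_congr_right fun hadj => ?_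
  constructor
  · rintro ⟨Z, hZ, hi, hj⟩
    obtain ⟨T, hT, hZ⟩ := mem_glue.mp hZ
    obtain ⟨X, hX, hTX, hiX⟩ := (hZ i).mp hi
    obtain ⟨Y, hY, hTY, hjY⟩ := (hZ j).mp hj
    by_contra hcon
    have hle' := Fin.le_def.mp hle
    have hside : ∀ B ∈ P ∪ Q, ∀ a ∈ B, ∀ b ∈ B, a ≤ i → b ≤ i := by
      intro B hB a ha b hb hai
      by_contra hbi
      have h1 := Fin.le_def.mp hai
      have h2 := Fin.lt_def.mp (not_le.mp hbi)
      exact hcon ⟨B, hB, (hoc B hB).out ha hb ⟨hai, Fin.le_def.mpr h2.le⟩,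
        (hoc B hB).out ha hb ⟨Fin.le_def.mpr (by omega), Fin.le_def.mpr (by omega)⟩⟩
    have hcls : ∀ E F, Relation.EqvGen (BlocksMeet (P ∪ Q)) E F →
        ((∀ a ∈ E, a ≤ i) ↔ ∀ a ∈ F, a ≤ i) := by
      intro E F hEF
      induction hEF with
      | rel E F hEF =>
        obtain ⟨hE, hF, a, ha⟩ := hEF
        obtain ⟨haE, haF⟩ := Finset.mem_inter.mp ha
        exact ⟨fun hs b hb => hside F hF a haF b hb (hs a haE),
          fun hs b hb => hside E hE a haE b hb (hs a haF)⟩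
      | refl => exact Iff.rfl
      | symm _ _ _ ih => exact ih.symm
      | trans _ _ _ _ _ ih ih' => exact ih.trans ih'
    have hXY := (hTX.symm.trans _ _ _ hTY)
    have hji := (hcls X Y hXY).mp (fun b hb => hside X hX i hiX b hb le_rfl) j hjY
    -- The side argument forces `j ≤ i`, so the cell is diagonal, and then `X` itself contains both
    -- entries.
    obtain rfl := le_antisymm hle hji
    exact hcon ⟨X, hX, hiX, hiX⟩
  · rintro ⟨B, hB, hi, hj⟩
    classical
    refine ⟨_, Finset.mem_image_of_mem _ hB, ?_, ?_⟩ <;>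
    · simp only [Finset.mem_biUnion, Finset.mem_filter, id]
      exact ⟨B, ⟨hB, .refl _⟩, by assumption⟩

/-- The bridge from gluing to graphs: from here on the equivalence closure is replaced by a union of
finite sets. -/
theorem glue_eq_iff {A A' A'' : Finset (Fin n)} (I : IntervalPartition A)
    (I' : IntervalPartition A') (J : IntervalPartition A'') :
    glue I.parts I'.parts = J.parts ↔
      cellsOf I.parts ∪ cellsOf I'.parts = cellsOf J.parts := by
  have hoc : ∀ B ∈ I.parts ∪ I'.parts, (B : Set (Fin n)).OrdConnected := fun B hB =>
    (Finset.mem_union.mp hB).elim (I.ordConnected B) (I'.ordConnected B)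
  have hne : ∀ B ∈ I.parts ∪ I'.parts, B.Nonempty := fun B hB =>
    (Finset.mem_union.mp hB).elim I.nonempty_of_mem_parts I'.nonempty_of_mem_parts
  rw [← cellsOf_union]
  exact ⟨fun h => by rw [← h, cellsOf_glue hoc], glue_eq_of_cells J hne hoc⟩

end Glue

/-! ### Restrictions of vincular permutations, up to relabelling -/

/-- The map on cells induced by an embedding of positions. -/
abbrev cellEmb {m n : ℕ} (e : Fin m ↪o Fin n) : Fin m × Fin m ↪ Fin n × Fin n :=
  e.toEmbedding.prodMap e.toEmbedding

theorem mem_map_cellEmb {m n : ℕ} {e : Fin m ↪o Fin n} {S : Finset (Fin m × Fin m)}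
    {i j : Fin n} :
    (i, j) ∈ S.map (cellEmb e) ↔ ∃ a b, (a, b) ∈ S ∧ e a = i ∧ e b = j := by
  simp [Finset.mem_map]

theorem mem_map_cellEmb_apply {m n : ℕ} {e : Fin m ↪o Fin n} {S : Finset (Fin m × Fin m)}
    {i j : Fin m} : (e i, e j) ∈ S.map (cellEmb e) ↔ (i, j) ∈ S :=
  Finset.mem_map' (cellEmb e) (a := (i, j))

namespace VincPerm

/-- The cells of the interval partition of a vincular permutation. -/
abbrev cells (x : VincPerm) : Finset (Fin x.size × Fin x.size) := cellsOf x.part.parts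

theorem self_mem_cells (x : VincPerm) (i : Fin x.size) : (i, i) ∈ x.cells :=
  (x.part.mem_iff_cells i).mp (Finset.mem_univ i)

/-- `x` is the standardization of the restriction of `z` to the subgraph with cells `S`, relabelled
along the embedding `e`. -/
structure IsRestriction (z : VincPerm) (S : Finset (Fin z.size × Fin z.size)) (x : VincPerm)
    (e : Fin x.size ↪o Fin z.size) : Prop where
  mem_range : ∀ i, (i, i) ∈ S → i ∈ Set.range e
  mem_cells : ∀ i j, (i, j) ∈ x.cells ↔ (e i, e j) ∈ S
  perm_lt : ∀ i j, x.perm i < x.perm j ↔ z.perm (e i) < z.perm (e j)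

/-- The hypothesis says that `σ⁻¹` followed by `τ` is an order automorphism of `Fin n`, and the
identity is the only one. -/
theorem _root_.VincularHopf.perm_eq_of_lt_iff {n : ℕ} {σ τ : Equiv.Perm (Fin n)}
    (h : ∀ i j, σ i < σ j ↔ τ i < τ j) : σ = τ := by
  let f : Fin n ≃o Fin n :=
    { toEquiv := σ.symm.trans τ
      map_rel_iff' := by
        intro a b
        have := h (σ.symm b) (σ.symm a)
        simp only [Equiv.apply_symm_apply] at this
        rw [← not_lt, ← not_lt, this]
        rfl }
  have hf : f = OrderIso.refl _ := Subsingleton.elim _ _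
  ext i
  have := DFunLike.congr_fun hf (σ i)
  simp only [f, OrderIso.refl_apply, RelIso.coe_fn_mk, Equiv.trans_apply,
    Equiv.symm_apply_apply] at this
  rw [this]

namespace IsRestriction

variable {z : VincPerm} {S : Finset (Fin z.size × Fin z.size)} {x y : VincPerm}
  {e : Fin x.size ↪o Fin z.size} {f : Fin y.size ↪o Fin z.size}

theorem range_eq (h : IsRestriction z S x e) : Set.range e = {i | (i, i) ∈ S} := by
  ext i
  constructor
  · rintro ⟨a, rfl⟩
    exact (h.mem_cells a a).mp (x.self_mem_cells a)
  · exact h.mem_range i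

/-- Both embeddings have the vertex set of `S` as range, so the sizes agree and then the embeddings
do; cells and relative order are then read off from `z`. This replaces computations with casts
between `Fin` types. -/
theorem unique (h : IsRestriction z S x e) (h' : IsRestriction z S y f) : x = y := by
  have hr : Set.range e = Set.range f := h.range_eq.trans h'.range_eq.symm
  obtain ⟨n, p, σ⟩ := x
  obtain ⟨m, q, τ⟩ := y
  obtain rfl : n = m := by
    have := congrArg Set.ncard hr
    simpa [← Set.image_univ, Set.ncard_image_of_injective, e.injective, f.injective,
      Set.ncard_univ] using this
  obtain rfl : e = f := OrderEmbedding.range_inj.mp hr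
  obtain rfl : p = q := by
    refine IntervalPartition.eq_of_cells_eq ?_
    ext ⟨i, j⟩
    exact (h.mem_cells i j).trans (h'.mem_cells i j).symm
  obtain rfl : σ = τ := perm_eq_of_lt_iff fun i j => (h.perm_lt i j).trans (h'.perm_lt i j).symm
  rfl

protected theorem refl (z : VincPerm) : IsRestriction z z.cells z (RelEmbedding.refl _) where
  mem_range i _ := ⟨i, rfl⟩
  mem_cells _ _ := Iff.rfl
  perm_lt _ _ := Iff.rfl

/-- Restriction in two stages is restriction along the composite embedding; coassociativity rests on
this. -/
protected theorem trans {T : Finset (Fin x.size × Fin x.size)} {w : VincPerm}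
    {g : Fin w.size ↪o Fin x.size} (h : IsRestriction z S x e) (h' : IsRestriction x T w g) :
    IsRestriction z (T.map (cellEmb e)) w (g.trans e) where
  mem_range i hi := by
    obtain ⟨a, b, hab, rfl, hb⟩ := mem_map_cellEmb.mp hi
    obtain rfl := e.injective hb
    obtain ⟨c, rfl⟩ := h'.mem_range _ hab
    exact ⟨c, rfl⟩
  mem_cells i j := by
    rw [h'.mem_cells]
    exact mem_map_cellEmb_apply.symm
  perm_lt i j := (h'.perm_lt i j).trans (h.perm_lt _ _)

theorem map_cells (h : IsRestriction z S x e) (hS : IsSubpath S) :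
    x.cells.map (cellEmb e) = S := by
  ext ⟨i, j⟩
  rw [mem_map_cellEmb]
  constructor
  · rintro ⟨a, b, hab, rfl, rfl⟩
    exact (h.mem_cells a b).mp hab
  · intro hij
    obtain ⟨a, rfl⟩ := h.mem_range _ (hS.left i j hij)
    obtain ⟨b, rfl⟩ := h.mem_range _ (hS.right _ j hij)
    exact ⟨a, b, (h.mem_cells a b).mpr hij, rfl, rfl⟩

end IsRestriction

/-! ### Standardization as restriction to a subgraph -/

theorem restrictPerm_lt {n : ℕ} (σ : Equiv.Perm (Fin n)) (A : Finset (Fin n))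
    (i j : Fin A.card) :
    restrictPerm σ A i < restrictPerm σ A j ↔
      σ (A.orderEmbOfFin rfl i) < σ (A.orderEmbOfFin rfl j) := by
  simp only [restrictPerm, Equiv.trans_apply]
  exact (OrderIso.lt_iff_lt ((A.map σ.toEmbedding).orderIsoOfFin (Finset.card_map _)).symm).trans
    Iff.rfl

/-- Adjacent ranks in `A` need not be adjacent positions in `[n]`, but they are when both positions
lie in one block: the block is an interval of `[n]` contained in `A`, so no position between them is
skipped. -/
theorem mem_cellsOf_std {n : ℕ} {A : Finset (Fin n)} (I : IntervalPartition A)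
    (i j : Fin A.card) : (i, j) ∈ cellsOf I.std.parts ↔
      (A.orderEmbOfFin rfl i, A.orderEmbOfFin rfl j) ∈ cellsOf I.parts := by
  set e := A.orderEmbOfFin rfl with he
  rw [mem_cellsOf, mem_cellsOf]
  have hsb : SameBlock I.std.parts i j ↔ SameBlock I.parts (e i) (e j) := by
    constructor
    · rintro ⟨C, hC, hi, hj⟩
      obtain ⟨B, hB, rfl⟩ := Finset.mem_image.mp hC
      exact ⟨B, hB, by simpa using hi, by simpa using hj⟩
    · rintro ⟨B, hB, hi, hj⟩
      exact ⟨_, Finset.mem_image_of_mem _ hB, by simpa using hi, by simpa using hj⟩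
  rw [hsb, e.le_iff_le, ← and_assoc, ← and_assoc]
  refine and_congr_left fun ⟨B, hB, hi, hj⟩ => and_congr_right fun hle => ?_
  constructor
  · intro hadj
    by_contra hcon
    -- If the positions were further apart, the position after `e i` would lie in the block, hence
    -- in `A`, with a rank strictly between `i` and `j`.
    have hk : (⟨(e i : ℕ) + 1, by omega⟩ : Fin n) ∈ B := (I.ordConnected B hB).out hi hj
      ⟨Fin.le_def.mpr (Nat.le_succ _), Fin.le_def.mpr (show (e i : ℕ) + 1 ≤ e j by omega)⟩
    have hkA : (⟨(e i : ℕ) + 1, by omega⟩ : Fin n) ∈ (A : Set (Fin n)) := I.le hB hk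
    rw [← A.range_orderEmbOfFin rfl] at hkA
    obtain ⟨l, hl⟩ := hkA
    rw [← he] at hl
    have h1 : i < l := e.lt_iff_lt.mp (by rw [hl]; exact Fin.lt_def.mpr (Nat.lt_succ_self _))
    have h2 : l < j := e.lt_iff_lt.mp
      (by rw [hl]; exact Fin.lt_def.mpr (show (e i : ℕ) + 1 < e j by omega))
    have h1' := Fin.lt_def.mp h1
    have h2' := Fin.lt_def.mp h2
    omega
  · intro hadj
    by_contra hcon
    -- A rank strictly between `i` and `j` would give a position strictly between two adjacent ones.
    have h1 : e i < e ⟨i + 1, by omega⟩ := e.lt_iff_lt.mpr (Fin.lt_def.mpr (by simp))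
    have h2 : e ⟨i + 1, by omega⟩ < e j := e.lt_iff_lt.mpr (Fin.lt_def.mpr (by simp; omega))
    have h1' := Fin.lt_def.mp h1
    have h2' := Fin.lt_def.mp h2
    omega

theorem isRestriction_restrict (z : VincPerm) {A : Finset (Fin z.size)} (I : IntervalPartition A) :
    IsRestriction z (cellsOf I.parts) (restrict z.perm I) (A.orderEmbOfFin rfl) where
  mem_range i hi :=
    (A.range_orderEmbOfFin rfl).ge ((I.mem_iff_cells i).mpr hi)
  mem_cells := mem_cellsOf_std I
  perm_lt := restrictPerm_lt _ _

open Classical in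
/-- The standardization of the restriction of `z` to the subgraph with cells `S`. -/
def res (z : VincPerm) (S : Finset (Fin z.size × Fin z.size)) : VincPerm :=
  if hS : IsSubpath S then restrict z.perm (ofCells S hS) else empty

theorem exists_isRestriction_res (z : VincPerm) {S : Finset (Fin z.size × Fin z.size)}
    (hS : IsSubpath S) : ∃ e, IsRestriction z S (z.res S) e := by
  rw [res, dif_pos hS]
  have := z.isRestriction_restrict (ofCells S hS)
  rw [cellsOf_ofCells] at this
  exact ⟨_, this⟩

theorem IsRestriction.eq_res {z x : VincPerm} {S : Finset (Fin z.size × Fin z.size)}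
    {e : Fin x.size ↪o Fin z.size} (h : IsRestriction z S x e) (hS : IsSubpath S) :
    z.res S = x :=
  (z.exists_isRestriction_res hS).choose_spec.unique h

theorem res_cellsOf (z : VincPerm) {A : Finset (Fin z.size)} (I : IntervalPartition A) :
    z.res (cellsOf I.parts) = restrict z.perm I :=
  (z.isRestriction_restrict I).eq_res (isSubpath_cellsOf _)

theorem res_cells (z : VincPerm) : z.res z.cells = z :=
  (IsRestriction.refl z).eq_res (isSubpath_cellsOf _)

/-! ### Concatenation -/

/-- The cells of `x`, with positions seen as natural numbers. -/
def Cell (x : VincPerm) (i j : ℕ) : Prop :=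
  ∃ (hi : i < x.size) (hj : j < x.size), (⟨i, hi⟩, ⟨j, hj⟩) ∈ x.cells

/-- The one-line notation of `x` (counted from `0`), extended by the identity. -/
def word (x : VincPerm) (i : ℕ) : ℕ :=
  if hi : i < x.size then x.perm ⟨i, hi⟩ else i

/-- Concatenations with different bracketing have sizes that are equal only propositionally.
Comparing cells and words over `ℕ` avoids transport between the corresponding `Fin` types. -/
theorem ext_of_val {x y : VincPerm} (hs : x.size = y.size)
    (hc : ∀ i j, x.Cell i j ↔ y.Cell i j) (hp : ∀ i, x.word i = y.word i) : x = y := by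
  obtain ⟨n, p, σ⟩ := x
  obtain ⟨m, q, τ⟩ := y
  obtain rfl : n = m := hs
  obtain rfl : p = q := by
    refine IntervalPartition.eq_of_cells_eq ?_
    ext ⟨i, j⟩
    have := hc i j
    simpa only [Cell, i.2, j.2, exists_true_left] using this
  obtain rfl : σ = τ := by
    ext i
    have := hp i
    simpa only [word, i.2, dite_true] using this
  rfl

/-- Every block of the concatenation comes from one factor, so no edge crosses the junction. -/
theorem mem_cells_conc (x y : VincPerm) (i j : Fin (x.size + y.size)) :
    (i, j) ∈ (x.conc y).cells ↔
      (∃ a b, (a, b) ∈ x.cells ∧ Fin.castAdd y.size a = i ∧ Fin.castAdd y.size b = j) ∨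
      ∃ a b, (a, b) ∈ y.cells ∧ Fin.natAdd x.size a = i ∧ Fin.natAdd x.size b = j := by
  change (i, j) ∈ cellsOf (StdIntervalPartition.conc x.part y.part).parts ↔ _
  have hsb : SameBlock (StdIntervalPartition.conc x.part y.part).parts i j ↔
      (∃ a b, SameBlock x.part.parts a b ∧ Fin.castAdd y.size a = i ∧ Fin.castAdd y.size b = j) ∨
      ∃ a b, SameBlock y.part.parts a b ∧ Fin.natAdd x.size a = i ∧ Fin.natAdd x.size b = j := by
    constructor
    · rintro ⟨B, hB, hi, hj⟩
      rcases Finset.mem_union.mp hB with h | h <;> obtain ⟨C, hC, rfl⟩ := Finset.mem_image.mp h <;>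
        obtain ⟨a, ha, rfl⟩ := Finset.mem_map.mp hi <;>
        obtain ⟨b, hb, rfl⟩ := Finset.mem_map.mp hj
      · exact .inl ⟨a, b, ⟨C, hC, ha, hb⟩, rfl, rfl⟩
      · exact .inr ⟨a, b, ⟨C, hC, ha, hb⟩, rfl, rfl⟩
    · rintro (⟨a, b, ⟨B, hB, ha, hb⟩, rfl, rfl⟩ | ⟨a, b, ⟨B, hB, ha, hb⟩, rfl, rfl⟩)
      · exact ⟨_, Finset.mem_union_left _ (Finset.mem_image_of_mem _ hB),
          Finset.mem_map_of_mem (Fin.castAddEmb _) ha, Finset.mem_map_of_mem (Fin.castAddEmb _) hb⟩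
      · exact ⟨_, Finset.mem_union_right _ (Finset.mem_image_of_mem _ hB),
          Finset.mem_map_of_mem (Fin.natAddEmb _) ha, Finset.mem_map_of_mem (Fin.natAddEmb _) hb⟩
  rw [mem_cellsOf, hsb]
  simp only [mem_cellsOf]
  constructor
  · rintro ⟨hle, hadj, ⟨a, b, h, rfl, rfl⟩ | ⟨a, b, h, rfl, rfl⟩⟩
    · exact .inl ⟨a, b, ⟨hle, hadj, h⟩, rfl, rfl⟩
    · refine .inr ⟨a, b, ⟨by simpa using hle, ?_, h⟩, rfl, rfl⟩
      simp at hadj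
      omega
  · rintro (⟨a, b, ⟨hle, hadj, h⟩, rfl, rfl⟩ | ⟨a, b, ⟨hle, hadj, h⟩, rfl, rfl⟩)
    · exact ⟨hle, hadj, .inl ⟨a, b, h, rfl, rfl⟩⟩
    · refine ⟨by simpa using hle, ?_, .inr ⟨a, b, h, rfl, rfl⟩⟩
      simp
      omega

theorem cell_conc (x y : VincPerm) (i j : ℕ) :
    (x.conc y).Cell i j ↔ x.Cell i j ∨
      (x.size ≤ i ∧ x.size ≤ j ∧ y.Cell (i - x.size) (j - x.size)) := by
  have hs : (x.conc y).size = x.size + y.size := rfl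
  constructor
  · rintro ⟨hi, hj, hij⟩
    rcases (mem_cells_conc x y _ _).mp hij with ⟨a, b, h, h1, h2⟩ | ⟨a, b, h, h1, h2⟩
    · obtain rfl : (a : ℕ) = i := congrArg Fin.val h1
      obtain rfl : (b : ℕ) = j := congrArg Fin.val h2
      exact .inl ⟨a.2, b.2, h⟩
    · obtain rfl : x.size + (a : ℕ) = i := congrArg Fin.val h1
      obtain rfl : x.size + (b : ℕ) = j := congrArg Fin.val h2
      refine .inr ⟨by simp, by simp, ?_⟩
      simp only [Nat.add_sub_cancel_left]
      exact ⟨a.2, b.2, h⟩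
  · rintro (⟨hi, hj, h⟩ | ⟨hi, hj, hi', hj', h⟩)
    · exact ⟨by omega, by omega, (mem_cells_conc x y _ _).mpr (.inl ⟨_, _, h, rfl, rfl⟩)⟩
    · exact ⟨by omega, by omega, (mem_cells_conc x y _ _).mpr
        (.inr ⟨_, _, h, Fin.ext (by simp; omega), Fin.ext (by simp; omega)⟩)⟩

theorem _root_.VincularHopf.concPerm_castAdd {m n : ℕ} (σ : Equiv.Perm (Fin m))
    (τ : Equiv.Perm (Fin n)) (i : Fin m) :
    concPerm σ τ (Fin.castAdd n i) = Fin.castAdd n (σ i) := by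
  simp [concPerm, Equiv.permCongr_apply]

theorem _root_.VincularHopf.concPerm_natAdd {m n : ℕ} (σ : Equiv.Perm (Fin m))
    (τ : Equiv.Perm (Fin n)) (i : Fin n) :
    concPerm σ τ (Fin.natAdd m i) = Fin.natAdd m (τ i) := by
  simp [concPerm, Equiv.permCongr_apply]

theorem word_conc (x y : VincPerm) (i : ℕ) :
    (x.conc y).word i = if i < x.size then x.word i else x.size + y.word (i - x.size) := by
  have hs : (x.conc y).size = x.size + y.size := rfl
  by_cases hi : i < x.size
  · rw [if_pos hi, word, word, dif_pos (by omega), dif_pos hi]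
    exact congrArg Fin.val (concPerm_castAdd x.perm y.perm ⟨i, hi⟩)
  · rw [if_neg hi, word, word]
    by_cases hi' : i - x.size < y.size
    · rw [dif_pos (by omega), dif_pos hi']
      refine Eq.trans ?_ (congrArg Fin.val (concPerm_natAdd x.perm y.perm ⟨i - x.size, hi'⟩))
      refine congrArg (fun k => ((concPerm x.perm y.perm k : Fin _) : ℕ)) (Fin.ext ?_)
      simp
      omega
    · rw [dif_neg (by omega), dif_neg hi']
      omega

theorem Cell.lt {x : VincPerm} {i j : ℕ} (h : x.Cell i j) : i < x.size ∧ j < x.size :=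
  ⟨h.1, h.2.1⟩

theorem not_cell_empty (i j : ℕ) : ¬ empty.Cell i j := fun h => Nat.not_lt_zero _ h.1

theorem word_empty (i : ℕ) : empty.word i = i := dif_neg (Nat.not_lt_zero i)

theorem size_conc (x y : VincPerm) : (x.conc y).size = x.size + y.size := rfl

theorem size_empty : empty.size = 0 := rfl

theorem conc_assoc (x y z : VincPerm) : (x.conc y).conc z = x.conc (y.conc z) := by
  refine ext_of_val (Nat.add_assoc _ _ _) (fun i j => ?_) (fun i => ?_)
  · simp only [cell_conc, size_conc, Nat.sub_sub]
    grind
  · simp only [word_conc, size_conc, Nat.sub_sub]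
    grind

theorem empty_conc (x : VincPerm) : empty.conc x = x := by
  refine ext_of_val (Nat.zero_add _) (fun i j => ?_) (fun i => ?_)
  · simp [cell_conc, size_empty, not_cell_empty]
  · simp [word_conc, size_empty]

theorem conc_empty (x : VincPerm) : x.conc empty = x := by
  refine ext_of_val (Nat.add_zero _) (fun i j => ?_) (fun i => ?_)
  · simp [cell_conc, not_cell_empty]
  · rw [word_conc, word_empty]
    split_ifs with h
    · rfl
    · rw [word, dif_neg h]
      omega

theorem eq_empty_of_size {x : VincPerm} (h : x.size = 0) : x = empty :=
  ext_of_val h (fun _ _ => iff_of_false (fun hc => by have := hc.lt; omega) (not_cell_empty _ _))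
    (fun i => by rw [word, dif_neg (by omega), word_empty])

/-- The union of a set of cells and of a shifted set of cells. -/
def joinCells {m n : ℕ} (S : Finset (Fin m × Fin m)) (T : Finset (Fin n × Fin n)) :
    Finset (Fin (m + n) × Fin (m + n)) :=
  S.map (cellEmb (Fin.castAddOrderEmb n)) ∪ T.map (cellEmb (Fin.natAddOrderEmb m))

theorem mem_joinCells {m n : ℕ} {S : Finset (Fin m × Fin m)} {T : Finset (Fin n × Fin n)}
    {i j : Fin (m + n)} : (i, j) ∈ joinCells S T ↔
      (∃ a b, (a, b) ∈ S ∧ Fin.castAdd n a = i ∧ Fin.castAdd n b = j) ∨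
      ∃ a b, (a, b) ∈ T ∧ Fin.natAdd m a = i ∧ Fin.natAdd m b = j := by
  rw [joinCells, Finset.mem_union, mem_map_cellEmb, mem_map_cellEmb]
  rfl

theorem cells_conc (x y : VincPerm) : (x.conc y).cells = joinCells x.cells y.cells :=
  Finset.ext fun ⟨i, j⟩ => (mem_cells_conc x y i j).trans mem_joinCells.symm

/-- The block sum of two maps. -/
def sumMap {m n m' n' : ℕ} (e : Fin m → Fin m') (f : Fin n → Fin n') :
    Fin (m + n) → Fin (m' + n') :=
  Fin.addCases (fun i => Fin.castAdd n' (e i)) (fun i => Fin.natAdd m' (f i))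

theorem sumMap_castAdd {m n m' n' : ℕ} (e : Fin m → Fin m') (f : Fin n → Fin n') (i : Fin m) :
    sumMap e f (Fin.castAdd n i) = Fin.castAdd n' (e i) := by
  rw [sumMap, Fin.addCases_left]

theorem sumMap_natAdd {m n m' n' : ℕ} (e : Fin m → Fin m') (f : Fin n → Fin n') (i : Fin n) :
    sumMap e f (Fin.natAdd m i) = Fin.natAdd m' (f i) := by
  rw [sumMap, Fin.addCases_right]

theorem strictMono_sumMap {m n m' n' : ℕ} {e : Fin m → Fin m'} {f : Fin n → Fin n'}
    (he : StrictMono e) (hf : StrictMono f) : StrictMono (sumMap e f) := by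
  intro i j hij
  induction i using Fin.addCases <;> induction j using Fin.addCases <;>
    simp only [sumMap_castAdd, sumMap_natAdd, Fin.natAdd_lt_natAdd_iff] at hij ⊢
  · exact he hij
  · simp only [Fin.lt_def, Fin.val_castAdd, Fin.val_natAdd]
    omega
  · simp only [Fin.lt_def, Fin.val_castAdd, Fin.val_natAdd] at hij
    omega
  · exact hf hij

/-- The block sum of two embeddings. -/
def sumEmb {m n m' n' : ℕ} (e : Fin m ↪o Fin m') (f : Fin n ↪o Fin n') :
    Fin (m + n) ↪o Fin (m' + n') :=
  OrderEmbedding.ofStrictMono (sumMap e f) (strictMono_sumMap e.strictMono f.strictMono)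

theorem sumEmb_castAdd {m n m' n' : ℕ} (e : Fin m ↪o Fin m') (f : Fin n ↪o Fin n') (i : Fin m) :
    sumEmb e f (Fin.castAdd n i) = Fin.castAdd n' (e i) :=
  sumMap_castAdd e f i

theorem sumEmb_natAdd {m n m' n' : ℕ} (e : Fin m ↪o Fin m') (f : Fin n ↪o Fin n') (i : Fin n) :
    sumEmb e f (Fin.natAdd m i) = Fin.natAdd m' (f i) :=
  sumMap_natAdd e f i

theorem mem_joinCells_castAdd {m n : ℕ} {S : Finset (Fin m × Fin m)} {T : Finset (Fin n × Fin n)}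
    {i j : Fin m} : (Fin.castAdd n i, Fin.castAdd n j) ∈ joinCells S T ↔ (i, j) ∈ S := by
  rw [mem_joinCells]
  constructor
  · rintro (⟨a, b, h, h1, h2⟩ | ⟨a, b, h, h1, h2⟩)
    · rwa [← Fin.castAdd_injective _ _ h1, ← Fin.castAdd_injective _ _ h2]
    · have := congrArg Fin.val h1
      simp at this
      omega
  · exact fun h => .inl ⟨i, j, h, rfl, rfl⟩

theorem mem_joinCells_natAdd {m n : ℕ} {S : Finset (Fin m × Fin m)} {T : Finset (Fin n × Fin n)}
    {i j : Fin n} : (Fin.natAdd m i, Fin.natAdd m j) ∈ joinCells S T ↔ (i, j) ∈ T := by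
  rw [mem_joinCells]
  constructor
  · rintro (⟨a, b, h, h1, h2⟩ | ⟨a, b, h, h1, h2⟩)
    · have := congrArg Fin.val h1
      simp at this
      omega
    · rwa [← Fin.natAdd_injective _ _ h1, ← Fin.natAdd_injective _ _ h2]
  · exact fun h => .inr ⟨i, j, h, rfl, rfl⟩

theorem not_mem_joinCells_castAdd_natAdd {m n : ℕ} {S : Finset (Fin m × Fin m)}
    {T : Finset (Fin n × Fin n)} {i : Fin m} {j : Fin n} :
    (Fin.castAdd n i, Fin.natAdd m j) ∉ joinCells S T := by
  rw [mem_joinCells]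
  rintro (⟨a, b, h, h1, h2⟩ | ⟨a, b, h, h1, h2⟩)
  · have := congrArg Fin.val h2
    simp at this
    omega
  · have := congrArg Fin.val h1
    simp at this
    omega

theorem not_mem_joinCells_natAdd_castAdd {m n : ℕ} {S : Finset (Fin m × Fin m)}
    {T : Finset (Fin n × Fin n)} {i : Fin m} {j : Fin n} :
    (Fin.natAdd m j, Fin.castAdd n i) ∉ joinCells S T := by
  rw [mem_joinCells]
  rintro (⟨a, b, h, h1, h2⟩ | ⟨a, b, h, h1, h2⟩)
  · have := congrArg Fin.val h1
    simp at this
    omega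
  · have := congrArg Fin.val h2
    simp at this
    omega

theorem concPerm_sumEmb_lt {m n m' n' : ℕ} {e : Fin m ↪o Fin m'} {f : Fin n ↪o Fin n'}
    {σ : Equiv.Perm (Fin m)} {τ : Equiv.Perm (Fin n)}
    {σ' : Equiv.Perm (Fin m')} {τ' : Equiv.Perm (Fin n')}
    (h : ∀ i j, σ i < σ j ↔ σ' (e i) < σ' (e j)) (h' : ∀ i j, τ i < τ j ↔ τ' (f i) < τ' (f j))
    (i j : Fin (m + n)) : concPerm σ τ i < concPerm σ τ j ↔
      concPerm σ' τ' (sumEmb e f i) < concPerm σ' τ' (sumEmb e f j) := by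
  induction i using Fin.addCases <;> induction j using Fin.addCases <;>
    simp only [concPerm_castAdd, concPerm_natAdd, sumEmb_castAdd, sumEmb_natAdd]
  · exact h _ _
  · simp only [Fin.lt_def, Fin.val_castAdd, Fin.val_natAdd]
    omega
  · simp only [Fin.lt_def, Fin.val_castAdd, Fin.val_natAdd]
    omega
  · simpa using h' _ _

theorem mem_joinCells_sumEmb {m n m' n' : ℕ} {e : Fin m ↪o Fin m'} {f : Fin n ↪o Fin n'}
    {S : Finset (Fin m × Fin m)} {T : Finset (Fin n × Fin n)}
    {S' : Finset (Fin m' × Fin m')} {T' : Finset (Fin n' × Fin n')}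
    (h : ∀ i j, (i, j) ∈ S ↔ (e i, e j) ∈ S') (h' : ∀ i j, (i, j) ∈ T ↔ (f i, f j) ∈ T')
    (i j : Fin (m + n)) :
    (i, j) ∈ joinCells S T ↔ (sumEmb e f i, sumEmb e f j) ∈ joinCells S' T' := by
  induction i using Fin.addCases <;> induction j using Fin.addCases <;>
    simp only [sumEmb_castAdd, sumEmb_natAdd, mem_joinCells_castAdd, mem_joinCells_natAdd,
      not_mem_joinCells_castAdd_natAdd, not_mem_joinCells_natAdd_castAdd]
  · exact h _ _
  · exact h' _ _

/-- The block sum of the two embeddings witnesses the restriction, since neither cells nor relative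
order mix the factors beyond placing all of `x` below all of `y`. -/
theorem IsRestriction.conc {x y x' y' : VincPerm} {S : Finset (Fin x.size × Fin x.size)}
    {T : Finset (Fin y.size × Fin y.size)} {e : Fin x'.size ↪o Fin x.size}
    {f : Fin y'.size ↪o Fin y.size} (h : IsRestriction x S x' e) (h' : IsRestriction y T y' f) :
    IsRestriction (x.conc y) (joinCells S T) (x'.conc y') (sumEmb e f) where
  mem_range i hi := by
    rcases mem_joinCells.mp hi with ⟨a, b, hab, rfl, hb⟩ | ⟨a, b, hab, rfl, hb⟩
    · rw [Fin.castAdd_injective _ _ hb] at hab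
      obtain ⟨c, rfl⟩ := h.mem_range _ hab
      exact ⟨Fin.castAdd _ c, sumEmb_castAdd e f c⟩
    · rw [Fin.natAdd_injective _ _ hb] at hab
      obtain ⟨c, rfl⟩ := h'.mem_range _ hab
      exact ⟨Fin.natAdd _ c, sumEmb_natAdd e f c⟩
  mem_cells i j := by
    rw [cells_conc]
    exact mem_joinCells_sumEmb h.mem_cells h'.mem_cells i j
  perm_lt := concPerm_sumEmb_lt h.perm_lt h'.perm_lt

end VincPerm

/-! ### Coverings of a subgraph by two subgraphs -/

section Coverings

variable {n : ℕ}

theorem IsSubpath.union {S T : Finset (Fin n × Fin n)} (hS : IsSubpath S) (hT : IsSubpath T) :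
    IsSubpath (S ∪ T) where
  le i j h := (Finset.mem_union.mp h).elim (hS.le i j) (hT.le i j)
  adj i j h := (Finset.mem_union.mp h).elim (hS.adj i j) (hT.adj i j)
  left i j h := Finset.mem_union.mpr
    ((Finset.mem_union.mp h).imp (hS.left i j) (hT.left i j))
  right i j h := Finset.mem_union.mpr
    ((Finset.mem_union.mp h).imp (hS.right i j) (hT.right i j))

/-- An order embedding may stretch an edge to non-adjacent positions; containment of the image in
the subpath `T` excludes this. -/
theorem IsSubpath.map {m : ℕ} {S : Finset (Fin m × Fin m)} {T : Finset (Fin n × Fin n)}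
    {e : Fin m ↪o Fin n} (hS : IsSubpath S) (hT : IsSubpath T) (h : S.map (cellEmb e) ⊆ T) :
    IsSubpath (S.map (cellEmb e)) where
  le i j hij := hT.le i j (h hij)
  adj i j hij := hT.adj i j (h hij)
  left i j hij := by
    obtain ⟨a, b, hab, rfl, rfl⟩ := mem_map_cellEmb.mp hij
    exact mem_map_cellEmb_apply.mpr (hS.left a b hab)
  right i j hij := by
    obtain ⟨a, b, hab, rfl, rfl⟩ := mem_map_cellEmb.mp hij
    exact mem_map_cellEmb_apply.mpr (hS.right a b hab)

theorem IsSubpath.of_map {m : ℕ} {S T : Finset (Fin m × Fin m)} {e : Fin m ↪o Fin n}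
    (hS : IsSubpath (S.map (cellEmb e))) (hT : IsSubpath T) (h : S ⊆ T) : IsSubpath S where
  le i j hij := hT.le i j (h hij)
  adj i j hij := hT.adj i j (h hij)
  left _ _ hij := mem_map_cellEmb_apply.mp (hS.left _ _ (mem_map_cellEmb_apply.mpr hij))
  right _ _ hij := mem_map_cellEmb_apply.mp (hS.right _ _ (mem_map_cellEmb_apply.mpr hij))

open Classical in
/-- The pairs of subgraphs with union `C`. -/
def coverings (C : Finset (Fin n × Fin n)) :
    Finset (Finset (Fin n × Fin n) × Finset (Fin n × Fin n)) :=
  Finset.univ.filter fun p => IsSubpath p.1 ∧ IsSubpath p.2 ∧ p.1 ∪ p.2 = C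

theorem mem_coverings {C : Finset (Fin n × Fin n)}
    {p : Finset (Fin n × Fin n) × Finset (Fin n × Fin n)} :
    p ∈ coverings C ↔ IsSubpath p.1 ∧ IsSubpath p.2 ∧ p.1 ∪ p.2 = C := by
  simp [coverings]

open Classical in
-- Reindexes by the equivalence between interval partitions and subgraphs. A general summand lets
-- the same identity serve the coproduct and the coefficients of the dual product.
theorem sum_intervalPartition {M : Type*} [AddCommMonoid M] (J : StdIntervalPartition n)
    (f : Finset (Fin n × Fin n) → Finset (Fin n × Fin n) → M) :
    (∑ A : Finset (Fin n), ∑ A' : Finset (Fin n), if A ∪ A' = Finset.univ then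
      ∑ I : IntervalPartition A, ∑ I' : IntervalPartition A',
        if glue I.parts I'.parts = J.parts then f (cellsOf I.parts) (cellsOf I'.parts) else 0
      else 0) = ∑ p ∈ coverings (cellsOf J.parts), f p.1 p.2 := by
  let c : (Σ A : Finset (Fin n), IntervalPartition A) → Finset (Fin n × Fin n) :=
    fun s => cellsOf s.2.parts
  calc
    _ = ∑ A : Finset (Fin n), ∑ A' : Finset (Fin n), ∑ I : IntervalPartition A,
        ∑ I' : IntervalPartition A', if cellsOf I.parts ∪ cellsOf I'.parts = cellsOf J.parts then
          f (cellsOf I.parts) (cellsOf I'.parts) else 0 := by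
      refine Finset.sum_congr rfl fun A _ => Finset.sum_congr rfl fun A' _ => ?_
      simp only [glue_eq_iff]
      split_ifs with h
      · rfl
      · refine (Finset.sum_eq_zero fun I _ => Finset.sum_eq_zero fun I' _ => if_neg ?_).symm
        -- The condition `A ∪ A' = univ` is redundant: `J` has every diagonal cell, so the vertex
        -- sets of a covering already exhaust `[n]`.
        refine fun hc => h (Finset.eq_univ_of_forall fun i => ?_)
        have hi := (J.mem_iff_cells i).mp (Finset.mem_univ i)
        rw [← hc, Finset.mem_union, ← I.mem_iff_cells, ← I'.mem_iff_cells] at hi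
        exact Finset.mem_union.mpr hi
    _ = ∑ s : (Σ A : Finset (Fin n), IntervalPartition A),
        ∑ s' : (Σ A : Finset (Fin n), IntervalPartition A),
          if c s ∪ c s' = cellsOf J.parts then f (c s) (c s') else 0 := by
      simp only [Fintype.sum_sigma]
      exact Finset.sum_congr rfl fun A _ => Finset.sum_comm
    _ = ∑ p ∈ Finset.univ.filter (fun p : (Σ A : Finset (Fin n), IntervalPartition A) ×
          (Σ A : Finset (Fin n), IntervalPartition A) => c p.1 ∪ c p.2 = cellsOf J.parts),
        f (c p.1) (c p.2) := by
      rw [Finset.sum_filter, Fintype.sum_prod_type]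
    _ = _ := by
      refine Finset.sum_bij (fun p _ => (c p.1, c p.2)) ?_ ?_ ?_ ?_
      · intro p hp
        exact mem_coverings.mpr ⟨isSubpath_cellsOf _, isSubpath_cellsOf _,
          (Finset.mem_filter.mp hp).2⟩
      · intro p _ q _ hpq
        exact Prod.ext (IntervalPartition.sigma_eq_of_cells_eq _ _ (congrArg Prod.fst hpq))
          (IntervalPartition.sigma_eq_of_cells_eq _ _ (congrArg Prod.snd hpq))
      · intro p hp
        obtain ⟨h1, h2, h3⟩ := mem_coverings.mp hp
        have e1 := cellsOf_ofCells _ h1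
        have e2 := cellsOf_ofCells _ h2
        refine ⟨(⟨_, ofCells _ h1⟩, ⟨_, ofCells _ h2⟩), ?_, Prod.ext e1 e2⟩
        simp only [Finset.mem_filter, Finset.mem_univ, true_and, c, e1, e2, h3]
      · intro p _
        rfl

/-- Both sides enumerate triples of subgraphs with union `C`; the bijection moves the middle one
from the left pair to the right pair. -/
theorem sum_coverings_assoc {M : Type*} [AddCommMonoid M] (C : Finset (Fin n × Fin n))
    (g : Finset (Fin n × Fin n) → Finset (Fin n × Fin n) → Finset (Fin n × Fin n) → M) :
    ∑ p ∈ coverings C, ∑ q ∈ coverings p.1, g q.1 q.2 p.2 =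
      ∑ p ∈ coverings C, ∑ q ∈ coverings p.2, g p.1 q.1 q.2 := by
  rw [Finset.sum_sigma', Finset.sum_sigma']
  refine Finset.sum_bij'
    (fun a _ => ⟨(a.2.1, a.2.2 ∪ a.1.2), (a.2.2, a.1.2)⟩)
    (fun b _ => ⟨(b.1.1 ∪ b.2.1, b.2.2), (b.1.1, b.2.1)⟩) ?_ ?_ ?_ ?_ ?_
  · rintro ⟨⟨P, P'⟩, ⟨Q, Q'⟩⟩ h
    simp only [Finset.mem_sigma, mem_coverings] at h ⊢
    obtain ⟨⟨hP, hP', rfl⟩, hQ, hQ', rfl⟩ := h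
    exact ⟨⟨hQ, hQ'.union hP', (Finset.union_assoc _ _ _).symm⟩, hQ', hP', trivial⟩
  · rintro ⟨⟨P, P'⟩, ⟨Q, Q'⟩⟩ h
    simp only [Finset.mem_sigma, mem_coverings] at h ⊢
    obtain ⟨⟨hP, hP', rfl⟩, hQ, hQ', rfl⟩ := h
    exact ⟨⟨hP.union hQ, hQ', Finset.union_assoc _ _ _⟩, hP, hQ, trivial⟩
  · rintro ⟨⟨P, P'⟩, ⟨Q, Q'⟩⟩ h
    simp only [Finset.mem_sigma, mem_coverings] at h
    obtain ⟨⟨hP, hP', rfl⟩, hQ, hQ', rfl⟩ := h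
    rfl
  · rintro ⟨⟨P, P'⟩, ⟨Q, Q'⟩⟩ h
    simp only [Finset.mem_sigma, mem_coverings] at h
    obtain ⟨⟨hP, hP', rfl⟩, hQ, hQ', rfl⟩ := h
    rfl
  · rintro ⟨⟨P, P'⟩, ⟨Q, Q'⟩⟩ _
    rfl

end Coverings

/-! ### Coverings under restriction -/

namespace VincPerm

/-- The embedding of `z.res S` into `z` carries its graph onto `S`, hence its coverings bijectively
onto those of `S`, and matches the iterated restrictions with single ones. -/
theorem sum_coverings_res {M : Type*} [AddCommMonoid M] (z : VincPerm)
    {S : Finset (Fin z.size × Fin z.size)} (hS : IsSubpath S) (g : VincPerm → VincPerm → M) :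
    ∑ q ∈ coverings (z.res S).cells, g ((z.res S).res q.1) ((z.res S).res q.2) =
      ∑ r ∈ coverings S, g (z.res r.1) (z.res r.2) := by
  obtain ⟨e, he⟩ := z.exists_isRestriction_res hS
  have hmap := he.map_cells hS
  have hcells : IsSubpath (z.res S).cells := isSubpath_cellsOf _
  have hsub : ∀ Q : Finset _, Q ⊆ (z.res S).cells → Q.map (cellEmb e) ⊆ S := fun Q hQ => by
    conv_rhs => rw [← hmap]
    exact Finset.map_subset_map.mpr hQ
  have hres : ∀ Q : Finset _, IsSubpath Q → Q ⊆ (z.res S).cells →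
      (z.res S).res Q = z.res (Q.map (cellEmb e)) := fun Q hQ hQS => by
    obtain ⟨f, hf⟩ := (z.res S).exists_isRestriction_res hQ
    exact ((he.trans hf).eq_res (hQ.map hS (hsub Q hQS))).symm
  have hle : ∀ q ∈ coverings (z.res S).cells,
      q.1 ⊆ (z.res S).cells ∧ q.2 ⊆ (z.res S).cells := fun q hq => by
    rw [← (mem_coverings.mp hq).2.2]
    exact ⟨Finset.subset_union_left, Finset.subset_union_right⟩
  refine Finset.sum_bij (fun q _ => (q.1.map (cellEmb e), q.2.map (cellEmb e))) ?_ ?_ ?_ ?_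
  · intro q hq
    obtain ⟨h1, h2, h3⟩ := mem_coverings.mp hq
    refine mem_coverings.mpr ⟨h1.map hS (hsub _ (hle q hq).1), h2.map hS (hsub _ (hle q hq).2), ?_⟩
    rw [← Finset.map_union, h3, hmap]
  · intro q _ q' _ h
    exact Prod.ext (Finset.map_injective _ (congrArg Prod.fst h))
      (Finset.map_injective _ (congrArg Prod.snd h))
  · intro r hr
    obtain ⟨h1, h2, h3⟩ := mem_coverings.mp hr
    have key : ∀ R : Finset _, R ⊆ S → ∃ Q ⊆ (z.res S).cells, Q.map (cellEmb e) = R := by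
      intro R hR
      rw [← hmap] at hR
      obtain ⟨Q, hQ, rfl⟩ := Finset.subset_map_iff.mp hR
      exact ⟨Q, hQ, rfl⟩
    obtain ⟨Q, hQ, e1⟩ := key r.1 (h3 ▸ Finset.subset_union_left)
    obtain ⟨Q', hQ', e2⟩ := key r.2 (h3 ▸ Finset.subset_union_right)
    refine ⟨(Q, Q'), mem_coverings.mpr ⟨?_, ?_, ?_⟩, Prod.ext e1 e2⟩
    · exact IsSubpath.of_map (e := e) (e1 ▸ h1) hcells hQ
    · exact IsSubpath.of_map (e := e) (e2 ▸ h2) hcells hQ'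
    · refine Finset.map_injective (cellEmb e) ?_
      rw [Finset.map_union, e1, e2, h3, hmap]
  · intro q hq
    obtain ⟨h1, h2, -⟩ := mem_coverings.mp hq
    rw [hres _ h1 (hle q hq).1, hres _ h2 (hle q hq).2]

/-! ### Coverings of a concatenation -/

section Join

variable {m n : ℕ}

/-- The cells of `Q` between the first `m` positions. -/
def leftCells (Q : Finset (Fin (m + n) × Fin (m + n))) : Finset (Fin m × Fin m) :=
  Finset.univ.filter fun p => (Fin.castAdd n p.1, Fin.castAdd n p.2) ∈ Q

/-- The cells of `Q` between the last `n` positions. -/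
def rightCells (Q : Finset (Fin (m + n) × Fin (m + n))) : Finset (Fin n × Fin n) :=
  Finset.univ.filter fun p => (Fin.natAdd m p.1, Fin.natAdd m p.2) ∈ Q

theorem leftCells_joinCells (S : Finset (Fin m × Fin m)) (T : Finset (Fin n × Fin n)) :
    leftCells (joinCells S T) = S := by
  ext ⟨i, j⟩
  simp [leftCells, mem_joinCells_castAdd]

theorem rightCells_joinCells (S : Finset (Fin m × Fin m)) (T : Finset (Fin n × Fin n)) :
    rightCells (joinCells S T) = T := by
  ext ⟨i, j⟩
  simp [rightCells, mem_joinCells_natAdd]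

/-- Containment in a joined set is what rules out cells of `Q` crossing the junction, which the two
halves would forget. -/
theorem joinCells_left_right {Q : Finset (Fin (m + n) × Fin (m + n))}
    {S : Finset (Fin m × Fin m)} {T : Finset (Fin n × Fin n)} (h : Q ⊆ joinCells S T) :
    joinCells (leftCells Q) (rightCells Q) = Q := by
  ext ⟨i, j⟩
  rw [mem_joinCells]
  constructor
  · rintro (⟨a, b, hab, rfl, rfl⟩ | ⟨a, b, hab, rfl, rfl⟩)
    · simpa [leftCells] using hab
    · simpa [rightCells] using hab
  · intro hij
    rcases mem_joinCells.mp (h hij) with ⟨a, b, -, rfl, rfl⟩ | ⟨a, b, -, rfl, rfl⟩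
    · exact .inl ⟨a, b, by simpa [leftCells] using hij, rfl, rfl⟩
    · exact .inr ⟨a, b, by simpa [rightCells] using hij, rfl, rfl⟩

theorem joinCells_union (S S' : Finset (Fin m × Fin m)) (T T' : Finset (Fin n × Fin n)) :
    joinCells S T ∪ joinCells S' T' = joinCells (S ∪ S') (T ∪ T') := by
  rw [joinCells, joinCells, joinCells, Finset.map_union, Finset.map_union,
    Finset.union_union_union_comm]

theorem leftCells_union (Q Q' : Finset (Fin (m + n) × Fin (m + n))) :
    leftCells (Q ∪ Q') = leftCells Q ∪ leftCells Q' := by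
  ext
  simp [leftCells]

theorem rightCells_union (Q Q' : Finset (Fin (m + n) × Fin (m + n))) :
    rightCells (Q ∪ Q') = rightCells Q ∪ rightCells Q' := by
  ext
  simp [rightCells]

theorem isSubpath_joinCells {S : Finset (Fin m × Fin m)} {T : Finset (Fin n × Fin n)}
    (hS : IsSubpath S) (hT : IsSubpath T) : IsSubpath (joinCells S T) where
  le i j h := by
    rcases mem_joinCells.mp h with ⟨a, b, hab, rfl, rfl⟩ | ⟨a, b, hab, rfl, rfl⟩
    · exact hS.le a b hab
    · simpa using hT.le a b hab
  adj i j h := by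
    rcases mem_joinCells.mp h with ⟨a, b, hab, rfl, rfl⟩ | ⟨a, b, hab, rfl, rfl⟩
    · exact hS.adj a b hab
    · have := hT.adj a b hab
      simp only [Fin.val_natAdd]
      omega
  left i j h := by
    rcases mem_joinCells.mp h with ⟨a, b, hab, rfl, rfl⟩ | ⟨a, b, hab, rfl, rfl⟩
    · exact mem_joinCells_castAdd.mpr (hS.left a b hab)
    · exact mem_joinCells_natAdd.mpr (hT.left a b hab)
  right i j h := by
    rcases mem_joinCells.mp h with ⟨a, b, hab, rfl, rfl⟩ | ⟨a, b, hab, rfl, rfl⟩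
    · exact mem_joinCells_castAdd.mpr (hS.right a b hab)
    · exact mem_joinCells_natAdd.mpr (hT.right a b hab)

theorem isSubpath_leftCells {Q : Finset (Fin (m + n) × Fin (m + n))} (hQ : IsSubpath Q) :
    IsSubpath (leftCells Q) := by
  have hmem : ∀ i j : Fin m, (i, j) ∈ leftCells Q ↔ (Fin.castAdd n i, Fin.castAdd n j) ∈ Q :=
    fun i j => by simp [leftCells]
  exact
    { le := fun i j h => hQ.le _ _ ((hmem i j).mp h)
      adj := fun i j h => hQ.adj _ _ ((hmem i j).mp h)
      left := fun i j h => (hmem i i).mpr (hQ.left _ _ ((hmem i j).mp h))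
      right := fun i j h => (hmem j j).mpr (hQ.right _ _ ((hmem i j).mp h)) }

theorem isSubpath_rightCells {Q : Finset (Fin (m + n) × Fin (m + n))} (hQ : IsSubpath Q) :
    IsSubpath (rightCells Q) := by
  have hmem : ∀ i j : Fin n, (i, j) ∈ rightCells Q ↔ (Fin.natAdd m i, Fin.natAdd m j) ∈ Q :=
    fun i j => by simp [rightCells]
  exact
    { le := fun i j h => by simpa using hQ.le _ _ ((hmem i j).mp h)
      adj := fun i j h => by
        have := hQ.adj _ _ ((hmem i j).mp h)
        simp only [Fin.val_natAdd] at this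
        omega
      left := fun i j h => (hmem i i).mpr (hQ.left _ _ ((hmem i j).mp h))
      right := fun i j h => (hmem j j).mpr (hQ.right _ _ ((hmem i j).mp h)) }

/-- A subgraph of a disjoint union is a pair of subgraphs, and unions are formed in each part
separately. -/
theorem sum_coverings_joinCells {M : Type*} [AddCommMonoid M] (C : Finset (Fin m × Fin m))
    (D : Finset (Fin n × Fin n))
    (g : Finset (Fin (m + n) × Fin (m + n)) → Finset (Fin (m + n) × Fin (m + n)) → M) :
    ∑ r ∈ coverings (joinCells C D), g r.1 r.2 =
      ∑ p ∈ coverings C, ∑ q ∈ coverings D, g (joinCells p.1 q.1) (joinCells p.2 q.2) := by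
  rw [← Finset.sum_product']
  refine Finset.sum_bij'
    (fun r _ => ((leftCells r.1, leftCells r.2), (rightCells r.1, rightCells r.2)))
    (fun s _ => (joinCells s.1.1 s.2.1, joinCells s.1.2 s.2.2)) ?_ ?_ ?_ ?_ ?_
  · intro r hr
    obtain ⟨h1, h2, h3⟩ := mem_coverings.mp hr
    refine Finset.mem_product.mpr ⟨mem_coverings.mpr
      ⟨isSubpath_leftCells h1, isSubpath_leftCells h2, ?_⟩, mem_coverings.mpr
      ⟨isSubpath_rightCells h1, isSubpath_rightCells h2, ?_⟩⟩
    · rw [← leftCells_union, h3, leftCells_joinCells]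
    · rw [← rightCells_union, h3, rightCells_joinCells]
  · intro s hs
    obtain ⟨h, h'⟩ := Finset.mem_product.mp hs
    obtain ⟨h1, h2, h3⟩ := mem_coverings.mp h
    obtain ⟨h1', h2', h3'⟩ := mem_coverings.mp h'
    refine mem_coverings.mpr ⟨isSubpath_joinCells h1 h1', isSubpath_joinCells h2 h2', ?_⟩
    rw [joinCells_union, h3, h3']
  · intro r hr
    have h3 := (mem_coverings.mp hr).2.2
    exact Prod.ext (joinCells_left_right (h3 ▸ Finset.subset_union_left))
      (joinCells_left_right (h3 ▸ Finset.subset_union_right))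
  · intro s _
    simp only [leftCells_joinCells, rightCells_joinCells]
  · intro r hr
    have h3 := (mem_coverings.mp hr).2.2
    dsimp only
    rw [joinCells_left_right (h3 ▸ Finset.subset_union_left),
      joinCells_left_right (h3 ▸ Finset.subset_union_right)]

end Join

theorem res_conc (x y : VincPerm) {S : Finset (Fin x.size × Fin x.size)}
    {T : Finset (Fin y.size × Fin y.size)} (hS : IsSubpath S) (hT : IsSubpath T) :
    (x.conc y).res (joinCells S T) = (x.res S).conc (y.res T) := by
  obtain ⟨e, he⟩ := x.exists_isRestriction_res hS
  obtain ⟨f, hf⟩ := y.exists_isRestriction_res hT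
  exact (he.conc hf).eq_res (isSubpath_joinCells hS hT)

theorem sum_coverings_conc {M : Type*} [AddCommMonoid M] (x y : VincPerm)
    (g : VincPerm → VincPerm → M) :
    ∑ r ∈ coverings (x.conc y).cells, g ((x.conc y).res r.1) ((x.conc y).res r.2) =
      ∑ p ∈ coverings x.cells, ∑ q ∈ coverings y.cells,
        g ((x.res p.1).conc (y.res q.1)) ((x.res p.2).conc (y.res q.2)) := by
  rw [cells_conc]
  refine (sum_coverings_joinCells x.cells y.cells
    fun r r' => g ((x.conc y).res r) ((x.conc y).res r')).trans ?_
  refine Finset.sum_congr rfl fun p hp => Finset.sum_congr rfl fun q hq => ?_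
  obtain ⟨h1, h2, -⟩ := mem_coverings.mp hp
  obtain ⟨h1', h2', -⟩ := mem_coverings.mp hq
  rw [res_conc x y h1 h1', res_conc x y h2 h2']

/-! ### Coverings with an empty member, for the counit -/

theorem res_eq_empty_iff (z : VincPerm) {S : Finset (Fin z.size × Fin z.size)}
    (hS : IsSubpath S) : z.res S = empty ↔ S = ∅ := by
  constructor
  · intro h
    obtain ⟨e, he⟩ := z.exists_isRestriction_res hS
    rw [← he.map_cells hS, Finset.map_eq_empty, h]
    rfl
  · rintro rfl
    exact IsRestriction.eq_res (e := Fin.castLEOrderEmb (Nat.zero_le _))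
      ⟨fun i hi => absurd hi (Finset.notMem_empty _), fun i => i.elim0, fun i => i.elim0⟩ hS

theorem coverings_empty_left {n : ℕ} {C : Finset (Fin n × Fin n)} (hC : IsSubpath C)
    {p : Finset (Fin n × Fin n) × Finset (Fin n × Fin n)} :
    p ∈ coverings C ∧ p.1 = ∅ ↔ p = (∅, C) := by
  rw [mem_coverings]
  constructor
  · rintro ⟨⟨-, -, h⟩, h1⟩
    exact Prod.ext h1 (by simpa [h1] using h)
  · rintro rfl
    exact ⟨⟨⟨by simp, by simp, by simp, by simp⟩, hC, by simp⟩, rfl⟩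

theorem coverings_empty_right {n : ℕ} {C : Finset (Fin n × Fin n)} (hC : IsSubpath C)
    {p : Finset (Fin n × Fin n) × Finset (Fin n × Fin n)} :
    p ∈ coverings C ∧ p.2 = ∅ ↔ p = (C, ∅) := by
  rw [mem_coverings]
  constructor
  · rintro ⟨⟨-, -, h⟩, h1⟩
    exact Prod.ext (by simpa [h1] using h) h1
  · rintro rfl
    exact ⟨⟨hC, ⟨by simp, by simp, by simp, by simp⟩, by simp⟩, rfl⟩

open Classical in
-- A restriction is empty only for the empty subgraph, so the one surviving covering pairs `∅` with
-- the whole graph.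
theorem sum_coverings_counit_left {M : Type*} [AddCommMonoid M] (z : VincPerm)
    (g : VincPerm → M) :
    ∑ p ∈ coverings z.cells, (if z.res p.1 = empty then g (z.res p.2) else 0) = g z := by
  have hC : IsSubpath z.cells := isSubpath_cellsOf _
  rw [Finset.sum_eq_single (∅, z.cells)]
  · have h := ((coverings_empty_left hC).mpr rfl).1
    rw [if_pos ((z.res_eq_empty_iff (mem_coverings.mp h).1).mpr rfl), res_cells]
  · intro p hp hne
    refine if_neg fun h => hne ((coverings_empty_left hC).mp ⟨hp, ?_⟩)
    exact (z.res_eq_empty_iff (mem_coverings.mp hp).1).mp h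
  · exact fun h => absurd ((coverings_empty_left hC).mpr rfl).1 h

open Classical in
theorem sum_coverings_counit_right {M : Type*} [AddCommMonoid M] (z : VincPerm)
    (g : VincPerm → M) :
    ∑ p ∈ coverings z.cells, (if z.res p.2 = empty then g (z.res p.1) else 0) = g z := by
  have hC : IsSubpath z.cells := isSubpath_cellsOf _
  rw [Finset.sum_eq_single (z.cells, ∅)]
  · have h := ((coverings_empty_right hC).mpr rfl).1
    rw [if_pos ((z.res_eq_empty_iff (mem_coverings.mp h).2.1).mpr rfl), res_cells]
  · intro p hp hne
    refine if_neg fun h => hne ((coverings_empty_right hC).mp ⟨hp, ?_⟩)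
    exact (z.res_eq_empty_iff (mem_coverings.mp hp).2.1).mp h
  · exact fun h => absurd ((coverings_empty_right hC).mpr rfl).1 h

end VincPerm

/-! ### Bialgebras given by structure maps -/

section Axioms

universe u v

variable {K : Type u} [Field K] {V : Type v} [AddCommGroup V] [Module K V]

/-- The axioms of a bialgebra, in terms of its structure maps. -/
structure BialgebraAxioms (mul : V →ₗ[K] V →ₗ[K] V) (comul : V →ₗ[K] V ⊗[K] V)
    (unit : K →ₗ[K] V) (counit : V →ₗ[K] K) : Prop where
  mul_assoc : ∀ x y z, mul (mul x y) z = mul x (mul y z)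
  one_mul : ∀ x, mul (unit 1) x = x
  mul_one : ∀ x, mul x (unit 1) = x
  coassoc : ∀ x, TensorProduct.assoc K V V V (comul.rTensor V (comul x)) =
    comul.lTensor V (comul x)
  counit_left : ∀ x, counit.rTensor V (comul x) = 1 ⊗ₜ x
  counit_right : ∀ x, counit.lTensor V (comul x) = x ⊗ₜ 1
  counit_one : counit (unit 1) = 1
  counit_mul : ∀ x y, counit (mul x y) = counit x * counit y
  comul_one : comul (unit 1) = unit 1 ⊗ₜ unit 1
  comul_mul : ∀ x y, comul (mul x y) = TensorProduct.map₂ mul mul (comul x) (comul y)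

namespace BialgebraAxioms

variable {mul : V →ₗ[K] V →ₗ[K] V} {comul : V →ₗ[K] V ⊗[K] V} {unit : K →ₗ[K] V}
  {counit : V →ₗ[K] K}

/-- A synonym of `V`, carrying the bialgebra structure with the given structure maps. -/
def Carrier (_ : BialgebraAxioms mul comul unit counit) : Type v := V

variable (h : BialgebraAxioms mul comul unit counit)

instance : AddCommGroup h.Carrier := inferInstanceAs (AddCommGroup V)

instance : Module K h.Carrier := inferInstanceAs (Module K V)

/-- The identity, as an isomorphism onto the synonym. -/
def toCarrier : V ≃ₗ[K] h.Carrier := LinearEquiv.refl K V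

instance : Ring h.Carrier :=
  { (inferInstance : AddCommGroup h.Carrier) with
    mul := fun x y => (mul x y : V)
    one := (unit 1 : V)
    mul_assoc := h.mul_assoc
    one_mul := h.one_mul
    mul_one := h.mul_one
    left_distrib := fun x y z => map_add (mul x) y z
    right_distrib := fun x y z => LinearMap.map_add₂ mul x y z
    zero_mul := fun x => LinearMap.map_zero₂ mul x
    mul_zero := fun x => map_zero (mul x) }

theorem toCarrier_mul (x y : V) : h.toCarrier (mul x y) = h.toCarrier x * h.toCarrier y := rfl

theorem toCarrier_one : h.toCarrier (unit 1) = 1 := rfl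

instance : Algebra K h.Carrier :=
  Algebra.ofModule (fun r x y => LinearMap.map_smul₂ mul r x y) (fun r x y => map_smul (mul x) r y)

theorem toCarrier_unit (c : K) : h.toCarrier (unit c) = algebraMap K h.Carrier c := by
  rw [Algebra.algebraMap_eq_smul_one, ← toCarrier_one, ← map_smul, ← map_smul, smul_eq_mul,
    _root_.mul_one]

instance : Coalgebra K h.Carrier where
  comul := (comul : V →ₗ[K] V ⊗[K] V)
  counit := (counit : V →ₗ[K] K)
  coassoc := LinearMap.ext h.coassoc
  rTensor_counit_comp_comul := LinearMap.ext h.counit_left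
  lTensor_counit_comp_comul := LinearMap.ext h.counit_right

theorem map_toCarrier (t : V ⊗[K] V) :
    TensorProduct.map h.toCarrier.toLinearMap h.toCarrier.toLinearMap t = t :=
  LinearMap.congr_fun (TensorProduct.map_id (R := K) (M := V) (N := V)) t

theorem comul_toCarrier (x : V) : Coalgebra.comul (R := K) (h.toCarrier x) =
    TensorProduct.map h.toCarrier.toLinearMap h.toCarrier.toLinearMap (comul x) :=
  (h.map_toCarrier _).symm

theorem counit_toCarrier (x : V) : Coalgebra.counit (R := K) (h.toCarrier x) = counit x := rfl

theorem map_toCarrier_map₂ (s t : V ⊗[K] V) :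
    TensorProduct.map h.toCarrier.toLinearMap h.toCarrier.toLinearMap
        (TensorProduct.map₂ mul mul s t) =
      TensorProduct.map h.toCarrier.toLinearMap h.toCarrier.toLinearMap s *
        TensorProduct.map h.toCarrier.toLinearMap h.toCarrier.toLinearMap t := by
  induction s with
  | zero => simp
  | add s s' hs hs' => simp only [map_add, LinearMap.add_apply, hs, hs', add_mul]
  | tmul a b =>
    induction t with
    | zero => simp
    | add t t' ht ht' => simp only [map_add, ht, ht', mul_add]
    | tmul c d =>
      simp only [TensorProduct.map₂_apply_tmul, TensorProduct.map_tmul,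
        Algebra.TensorProduct.tmul_mul_tmul, LinearEquiv.coe_coe, toCarrier_mul]

instance : Bialgebra K h.Carrier :=
  Bialgebra.mk' K h.Carrier
    (by rw [← toCarrier_one]; exact h.counit_one)
    (fun {a b} => h.counit_mul a b)
    (by
      rw [← toCarrier_one]
      refine (h.comul_toCarrier _).trans ?_
      rw [h.comul_one]
      rfl)
    (fun {a b} => by
      obtain ⟨x, rfl⟩ := h.toCarrier.surjective a
      obtain ⟨y, rfl⟩ := h.toCarrier.surjective b
      rw [← toCarrier_mul]
      refine (h.comul_toCarrier _).trans ?_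
      rw [h.comul_mul, map_toCarrier_map₂, ← comul_toCarrier, ← comul_toCarrier])

theorem isBialgebra (h : BialgebraAxioms mul comul unit counit) :
    IsBialgebra mul comul unit counit :=
  ⟨h.Carrier, inferInstance, inferInstance, h.toCarrier, h.toCarrier_mul, h.toCarrier_unit,
    h.comul_toCarrier, h.counit_toCarrier⟩

/-- A left inverse `S` and a right inverse `T` of the identity in the convolution monoid coincide,
so the two one-sided equations may be solved independently. -/
theorem isHopfAlgebra (h : BialgebraAxioms mul comul unit counit) {S T : V →ₗ[K] V}
    (hS : ∀ x, TensorProduct.lift mul (S.rTensor V (comul x)) = unit (counit x))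
    (hT : ∀ x, TensorProduct.lift mul (T.lTensor V (comul x)) = unit (counit x)) :
    IsHopfAlgebra mul comul unit counit S := by
  let S' : h.Carrier →ₗ[K] h.Carrier := S
  let T' : h.Carrier →ₗ[K] h.Carrier := T
  have hu : ∀ c : K, algebraMap K h.Carrier c = unit c := fun c => (h.toCarrier_unit c).symm
  have hS' : WithConv.toConv S' * WithConv.toConv LinearMap.id = 1 := by
    refine WithConv.ext (LinearMap.ext fun x => ?_)
    exact (hS x).trans (hu _).symm
  have hT' : WithConv.toConv LinearMap.id * WithConv.toConv T' = 1 := by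
    refine WithConv.ext (LinearMap.ext fun x => ?_)
    exact (hT x).trans (hu _).symm
  have hST : S' = T' := congrArg WithConv.ofConv (left_inv_eq_right_inv hS' hT')
  let hopf : HopfAlgebra K h.Carrier :=
    { (inferInstance : Bialgebra K h.Carrier) with
      antipode := S'
      mul_antipode_rTensor_comul := LinearMap.ext fun x => (hS x).trans (hu _).symm
      mul_antipode_lTensor_comul := by
        rw [hST]
        exact LinearMap.ext fun x => (hT x).trans (hu _).symm }
  exact ⟨h.Carrier, inferInstance, hopf, h.toCarrier, h.toCarrier_mul, h.toCarrier_unit,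
    h.comul_toCarrier, h.counit_toCarrier, fun _ => rfl⟩

end BialgebraAxioms

/-! ### Duality -/

/-- The pairing between tensor products induced by two pairings. -/
def tensorPairing {V' : Type*} [AddCommGroup V'] [Module K V'] (B : V →ₗ[K] V →ₗ[K] K)
    (B' : V' →ₗ[K] V' →ₗ[K] K) : V ⊗[K] V' →ₗ[K] V ⊗[K] V' →ₗ[K] K :=
  (TensorProduct.map₂ B B').compr₂ (LinearMap.mul' K K)

theorem tensorPairing_tmul {V' : Type*} [AddCommGroup V'] [Module K V'] (B : V →ₗ[K] V →ₗ[K] K)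
    (B' : V' →ₗ[K] V' →ₗ[K] K) (x y : V) (x' y' : V') :
    tensorPairing B B' (x ⊗ₜ x') (y ⊗ₜ y') = B x y * B' x' y' := by
  simp [tensorPairing, TensorProduct.map₂_apply_tmul]

/-- Orthonormality of a basis passes to tensor products. Applying this twice makes the pairing on
the triple tensor product nondegenerate too, as coassociativity requires. -/
theorem tensorPairing_basis {V' ι ι' : Type*} [AddCommGroup V'] [Module K V']
    {B : V →ₗ[K] V →ₗ[K] K} {B' : V' →ₗ[K] V' →ₗ[K] K} {b : Module.Basis ι K V}
    {b' : Module.Basis ι' K V'} (hb : ∀ x i, B x (b i) = b.repr x i)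
    (hb' : ∀ x i, B' x (b' i) = b'.repr x i) (t : V ⊗[K] V') (i : ι × ι') :
    tensorPairing B B' t (b.tensorProduct b' i) = (b.tensorProduct b').repr t i := by
  rw [Module.Basis.tensorProduct_apply']
  induction t with
  | zero => simp
  | add s t hs ht => simp only [map_add, LinearMap.add_apply, Finsupp.add_apply, hs, ht]
  | tmul x y =>
    rw [tensorPairing_tmul, Module.Basis.tensorProduct_repr_tmul_apply, hb, hb', smul_eq_mul,
      mul_comm]

theorem eq_of_pairing_eq {ι : Type*} {B : V →ₗ[K] V →ₗ[K] K} {b : Module.Basis ι K V}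
    (hb : ∀ x i, B x (b i) = b.repr x i) {x y : V} (h : ∀ i, B x (b i) = B y (b i)) : x = y :=
  b.ext_elem fun i => by rw [← hb, ← hb, h]

/-- The dual of a bialgebra, with respect to a pairing for which some basis is orthonormal. -/
theorem BialgebraAxioms.dual {mul mul' : V →ₗ[K] V →ₗ[K] V} {comul comul' : V →ₗ[K] V ⊗[K] V}
    {unit : K →ₗ[K] V} {counit : V →ₗ[K] K} (h : BialgebraAxioms mul comul unit counit)
    {ι : Type*} {B : V →ₗ[K] V →ₗ[K] K} {b : Module.Basis ι K V}
    (hb : ∀ x i, B x (b i) = b.repr x i)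
    (hmul : ∀ x y z, B (mul' x y) z = tensorPairing B B (x ⊗ₜ y) (comul z))
    (hcomul : ∀ x y z, tensorPairing B B (comul' x) (y ⊗ₜ z) = B x (mul y z))
    (hunit : ∀ x, B (unit 1) x = counit x) (hcounit : ∀ x, B x (unit 1) = counit x) :
    BialgebraAxioms mul' comul' unit counit := by
  have ext2 : ∀ s t : V ⊗[K] V,
      (∀ y z, tensorPairing B B s (y ⊗ₜ z) = tensorPairing B B t (y ⊗ₜ z)) → s = t := by
    intro s t hst
    refine eq_of_pairing_eq (tensorPairing_basis hb hb) fun i => ?_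
    rw [Module.Basis.tensorProduct_apply']
    exact hst _ _
  have ext3 : ∀ s t : V ⊗[K] (V ⊗[K] V),
      (∀ x y z, tensorPairing B (tensorPairing B B) s (x ⊗ₜ (y ⊗ₜ z)) =
        tensorPairing B (tensorPairing B B) t (x ⊗ₜ (y ⊗ₜ z))) → s = t := by
    intro s t hst
    refine eq_of_pairing_eq (tensorPairing_basis hb (tensorPairing_basis hb hb)) fun i => ?_
    rw [Module.Basis.tensorProduct_apply', Module.Basis.tensorProduct_apply']
    exact hst _ _ _
  have mulL : ∀ x y z t, tensorPairing B B (mul' x y ⊗ₜ z) t =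
      tensorPairing B (tensorPairing B B) (x ⊗ₜ (y ⊗ₜ z))
        (TensorProduct.assoc K V V V (comul.rTensor V t)) := by
    intro x y z t
    induction t with
    | zero => simp
    | add s t hs ht => simp only [map_add, hs, ht]
    | tmul u v =>
      rw [tensorPairing_tmul, hmul, LinearMap.rTensor_tmul]
      induction comul u with
      | zero => simp
      | add s t hs ht => simp only [map_add, add_mul, TensorProduct.add_tmul, hs, ht]
      | tmul p q =>
        rw [TensorProduct.assoc_tmul, tensorPairing_tmul, tensorPairing_tmul, tensorPairing_tmul,
          _root_.mul_assoc]
  have mulR : ∀ x y z t, tensorPairing B B (x ⊗ₜ mul' y z) t =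
      tensorPairing B (tensorPairing B B) (x ⊗ₜ (y ⊗ₜ z)) (comul.lTensor V t) := by
    intro x y z t
    induction t with
    | zero => simp
    | add s t hs ht => simp only [map_add, hs, ht]
    | tmul u v => rw [tensorPairing_tmul, hmul, LinearMap.lTensor_tmul, tensorPairing_tmul]
  have comulL : ∀ x y z t, tensorPairing B (tensorPairing B B)
      (TensorProduct.assoc K V V V (comul'.rTensor V t)) (x ⊗ₜ (y ⊗ₜ z)) =
        tensorPairing B B t (mul x y ⊗ₜ z) := by
    intro x y z t
    induction t with
    | zero => simp
    | add s t hs ht => simp only [map_add, LinearMap.add_apply, hs, ht]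
    | tmul u v =>
      rw [tensorPairing_tmul, ← hcomul, LinearMap.rTensor_tmul]
      induction comul' u with
      | zero => simp
      | add s t hs ht =>
        simp only [map_add, LinearMap.add_apply, add_mul, TensorProduct.add_tmul, hs, ht]
      | tmul p q =>
        rw [TensorProduct.assoc_tmul, tensorPairing_tmul, tensorPairing_tmul, tensorPairing_tmul,
          _root_.mul_assoc]
  have comulR : ∀ x y z t, tensorPairing B (tensorPairing B B) (comul'.lTensor V t)
      (x ⊗ₜ (y ⊗ₜ z)) = tensorPairing B B t (x ⊗ₜ mul y z) := by
    intro x y z t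
    induction t with
    | zero => simp
    | add s t hs ht => simp only [map_add, LinearMap.add_apply, hs, ht]
    | tmul u v => rw [tensorPairing_tmul, ← hcomul, LinearMap.lTensor_tmul, tensorPairing_tmul]
  have unitL : ∀ x t, tensorPairing B B (unit 1 ⊗ₜ x) t =
      B x (TensorProduct.lid K V (counit.rTensor V t)) := by
    intro x t
    induction t with
    | zero => simp
    | add s t hs ht => simp only [map_add, hs, ht]
    | tmul u v => simp [tensorPairing_tmul, hunit]
  have unitR : ∀ x t, tensorPairing B B (x ⊗ₜ unit 1) t =
      B x (TensorProduct.rid K V (counit.lTensor V t)) := by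
    intro x t
    induction t with
    | zero => simp
    | add s t hs ht => simp only [map_add, hs, ht]
    | tmul u v => simp [tensorPairing_tmul, hunit, mul_comm]
  have counitL : ∀ x t, tensorPairing B B t (unit 1 ⊗ₜ x) =
      B (TensorProduct.lid K V (counit.rTensor V t)) x := by
    intro x t
    induction t with
    | zero => simp
    | add s t hs ht => simp only [map_add, LinearMap.add_apply, hs, ht]
    | tmul u v => simp [tensorPairing_tmul, hcounit]
  have counitR : ∀ x t, tensorPairing B B t (x ⊗ₜ unit 1) =
      B (TensorProduct.rid K V (counit.lTensor V t)) x := by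
    intro x t
    induction t with
    | zero => simp
    | add s t hs ht => simp only [map_add, LinearMap.add_apply, hs, ht]
    | tmul u v => simp [tensorPairing_tmul, hcounit, mul_comm]
  -- The next two identities move a product or a coproduct across the pairing in both factors at
  -- once; the interchange of the middle tensor factors appears the same way in each, so
  -- compatibility is self-dual.
  have mulmul : ∀ s t p q, tensorPairing B B (TensorProduct.map₂ mul' mul' s t) (p ⊗ₜ q) =
      tensorPairing (tensorPairing B B) (tensorPairing B B) (s ⊗ₜ t)
        (TensorProduct.tensorTensorTensorComm K V V V V (comul p ⊗ₜ comul q)) := by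
    intro s t p q
    induction s with
    | zero => simp
    | add s s' hs hs' => simp only [map_add, LinearMap.add_apply, TensorProduct.add_tmul, hs, hs']
    | tmul a b =>
      induction t with
      | zero => simp
      | add t t' ht ht' =>
        simp only [map_add, LinearMap.add_apply, TensorProduct.tmul_add, ht, ht']
      | tmul c d =>
        rw [TensorProduct.map₂_apply_tmul, TensorProduct.map_tmul, tensorPairing_tmul, hmul, hmul]
        induction comul p with
        | zero => simp
        | add s s' hs hs' => simp only [map_add, add_mul, TensorProduct.add_tmul, hs, hs']
        | tmul i j =>
          induction comul q with
          | zero => simp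
          | add s s' hs hs' => simp only [map_add, mul_add, TensorProduct.tmul_add, hs, hs']
          | tmul k l =>
            rw [TensorProduct.tensorTensorTensorComm_tmul]
            simp only [tensorPairing_tmul]
            ring
  have comulcomul : ∀ x y s t, tensorPairing B B (x ⊗ₜ y) (TensorProduct.map₂ mul mul s t) =
      tensorPairing (tensorPairing B B) (tensorPairing B B) (comul' x ⊗ₜ comul' y)
        (TensorProduct.tensorTensorTensorComm K V V V V (s ⊗ₜ t)) := by
    intro x y s t
    induction s with
    | zero => simp
    | add s s' hs hs' => simp only [map_add, LinearMap.add_apply, TensorProduct.add_tmul, hs, hs']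
    | tmul a b =>
      induction t with
      | zero => simp
      | add t t' ht ht' =>
        simp only [map_add, TensorProduct.tmul_add, ht, ht']
      | tmul c d =>
        rw [TensorProduct.map₂_apply_tmul, TensorProduct.map_tmul, tensorPairing_tmul,
          TensorProduct.tensorTensorTensorComm_tmul, tensorPairing_tmul, hcomul, hcomul]
  -- Each axiom is the mirror of an old one: associativity and coassociativity trade places, as do
  -- the unit and counit laws, and `counit_mul` and `comul_one`; `comul_mul` is its own mirror.
  refine ⟨?_, ?_, ?_, ?_, ?_, ?_, h.counit_one, ?_, ?_, ?_⟩
  · intro x y z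
    refine eq_of_pairing_eq hb fun i => ?_
    rw [hmul, mulL, h.coassoc, ← mulR, ← hmul]
  · intro x
    refine eq_of_pairing_eq hb fun i => ?_
    rw [hmul, unitL, h.counit_left, TensorProduct.lid_tmul, one_smul]
  · intro x
    refine eq_of_pairing_eq hb fun i => ?_
    rw [hmul, unitR, h.counit_right, TensorProduct.rid_tmul, one_smul]
  · intro x
    refine ext3 _ _ fun u v w => ?_
    rw [comulL, comulR, hcomul, hcomul, h.mul_assoc]
  · intro x
    refine (TensorProduct.lid K V).injective (eq_of_pairing_eq hb fun i => ?_)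
    rw [← counitL, hcomul, h.one_mul, TensorProduct.lid_tmul, one_smul]
  · intro x
    refine (TensorProduct.rid K V).injective (eq_of_pairing_eq hb fun i => ?_)
    rw [← counitR, hcomul, h.mul_one, TensorProduct.rid_tmul, one_smul]
  · intro x y
    rw [← hcounit, hmul, h.comul_one, tensorPairing_tmul, hcounit, hcounit]
  · refine ext2 _ _ fun u v => ?_
    rw [hcomul, hunit, h.counit_mul, tensorPairing_tmul, hunit, hunit]
  · intro x y
    refine ext2 _ _ fun u v => ?_
    rw [hcomul, hmul, h.comul_mul, mulmul, comulcomul]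

end Axioms

/-! ### The bialgebra with the concatenation product -/

@[elab_as_elim]
theorem basis_induction {p : FreeVincPerm → Prop} (v : FreeVincPerm) (zero : p 0)
    (add : ∀ v w, p v → p w → p (v + w)) (smul : ∀ (c : ℚ) v, p v → p (c • v))
    (basis : ∀ x, p (basisVec x)) : p v := by
  induction v using Finsupp.induction_linear with
  | zero => exact zero
  | add v w hv hw => exact add v w hv hw
  | single x c =>
    have := smul c _ (basis x)
    rwa [Finsupp.smul_single, smul_eq_mul, mul_one] at this

theorem ext_basis {M : Type*} [AddCommGroup M] [Module ℚ M] {f g : FreeVincPerm →ₗ[ℚ] M}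
    (h : ∀ x, f (basisVec x) = g (basisVec x)) (v : FreeVincPerm) : f v = g v := by
  induction v using basis_induction with
  | zero => simp
  | add v w hv hw => rw [map_add, map_add, hv, hw]
  | smul c v hv => rw [map_smul, map_smul, hv]
  | basis x => exact h x

theorem mulConc_basisVec (x y : VincPerm) :
    mulConc (basisVec x) (basisVec y) = basisVec (x.conc y) := by
  simp [mulConc]

theorem comulDeconc_basisVec (z : VincPerm) : comulDeconc (basisVec z) =
    ∑ p ∈ z.finite_conc_eq.toFinset, basisVec p.1 ⊗ₜ[ℚ] basisVec p.2 := by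
  simp [comulDeconc]

theorem comulGlue_basisVec (z : VincPerm) : comulGlue (basisVec z) =
    ∑ p ∈ coverings z.cells, basisVec (z.res p.1) ⊗ₜ[ℚ] basisVec (z.res p.2) := by
  rw [← sum_intervalPartition z.part fun S S' => basisVec (z.res S) ⊗ₜ[ℚ] basisVec (z.res S')]
  simp only [comulGlue, Finsupp.linearCombination_single, one_smul, VincPerm.res_cellsOf]

open Classical in
theorem glueCoeff_eq (x y z : VincPerm) : glueCoeff x y z =
    ∑ p ∈ coverings z.cells, if z.res p.1 = x ∧ z.res p.2 = y then 1 else 0 := by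
  rw [← sum_intervalPartition z.part fun S S' => if z.res S = x ∧ z.res S' = y then (1 : ℚ) else 0]
  simp only [glueCoeff, VincPerm.res_cellsOf, ite_and]

theorem unitMap_one : unitMap 1 = basisVec VincPerm.empty := rfl

open Classical in
theorem counitMap_basisVec (x : VincPerm) :
    counitMap (basisVec x) = if x = VincPerm.empty then 1 else 0 := by
  simp [counitMap, Finsupp.single_apply]

theorem VincPerm.conc_eq_empty_iff {x y : VincPerm} : x.conc y = empty ↔ x = empty ∧ y = empty := by
  constructor
  · intro h
    have := congrArg size h
    rw [size_conc, size_empty] at this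
    exact ⟨eq_empty_of_size (by omega), eq_empty_of_size (by omega)⟩
  · rintro ⟨rfl, rfl⟩
    exact empty_conc empty

/-- By multilinearity everything is checked on basis elements, where each axiom involving the
coproduct is an identity between sums over coverings. -/
theorem bialgebraAxioms_conc :
    BialgebraAxioms mulConc comulGlue unitMap counitMap where
  mul_assoc u v w := by
    induction u using basis_induction with
    | zero => simp
    | add u u' hu hu' => simp only [map_add, LinearMap.add_apply, hu, hu']
    | smul c u hu => simp only [map_smul, LinearMap.smul_apply, hu]
    | basis x =>
      induction v using basis_induction with
      | zero => simp
      | add v v' hv hv' => simp only [map_add, LinearMap.add_apply, hv, hv']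
      | smul c v hv => simp only [map_smul, LinearMap.smul_apply, hv]
      | basis y =>
        induction w using basis_induction with
        | zero => simp
        | add w w' hw hw' => simp only [map_add, hw, hw']
        | smul c w hw => simp only [map_smul, hw]
        | basis z => simp only [mulConc_basisVec, VincPerm.conc_assoc]
  one_mul := ext_basis (f := mulConc (unitMap 1)) (g := LinearMap.id) fun x => by
    rw [unitMap_one, mulConc_basisVec, VincPerm.empty_conc, LinearMap.id_apply]
  mul_one := ext_basis (f := mulConc.flip (unitMap 1)) (g := LinearMap.id) fun x => by
    rw [unitMap_one, LinearMap.flip_apply, mulConc_basisVec, VincPerm.conc_empty,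
      LinearMap.id_apply]
  coassoc := ext_basis
    (f := (TensorProduct.assoc ℚ _ _ _).toLinearMap ∘ₗ comulGlue.rTensor _ ∘ₗ comulGlue)
    (g := comulGlue.lTensor _ ∘ₗ comulGlue) fun z => by
    let g : VincPerm → VincPerm → VincPerm → FreeVincPerm ⊗[ℚ] (FreeVincPerm ⊗[ℚ] FreeVincPerm) :=
      fun a b c => basisVec a ⊗ₜ (basisVec b ⊗ₜ basisVec c)
    have hl : ∀ p ∈ coverings z.cells,
        TensorProduct.assoc ℚ _ _ _ (comulGlue (basisVec (z.res p.1)) ⊗ₜ basisVec (z.res p.2)) =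
          ∑ q ∈ coverings p.1, g (z.res q.1) (z.res q.2) (z.res p.2) := fun p hp => by
      rw [← z.sum_coverings_res (mem_coverings.mp hp).1 fun a b => g a b (z.res p.2),
        comulGlue_basisVec, TensorProduct.sum_tmul, map_sum]
      rfl
    have hr : ∀ p ∈ coverings z.cells,
        basisVec (z.res p.1) ⊗ₜ comulGlue (basisVec (z.res p.2)) =
          ∑ q ∈ coverings p.2, g (z.res p.1) (z.res q.1) (z.res q.2) := fun p hp => by
      rw [← z.sum_coverings_res (mem_coverings.mp hp).2.1 fun a b => g (z.res p.1) a b,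
        comulGlue_basisVec, TensorProduct.tmul_sum]
    simp only [LinearMap.comp_apply, LinearEquiv.coe_coe, comulGlue_basisVec z, map_sum,
      LinearMap.rTensor_tmul, LinearMap.lTensor_tmul]
    rw [Finset.sum_congr rfl hl, Finset.sum_congr rfl hr]
    exact sum_coverings_assoc z.cells fun a b c => g (z.res a) (z.res b) (z.res c)
  counit_left := ext_basis (f := counitMap.rTensor _ ∘ₗ comulGlue)
    (g := TensorProduct.mk ℚ ℚ FreeVincPerm 1) fun z => by
    simp only [LinearMap.comp_apply, comulGlue_basisVec z, map_sum, LinearMap.rTensor_tmul,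
      counitMap_basisVec, TensorProduct.mk_apply, TensorProduct.ite_tmul]
    exact z.sum_coverings_counit_left fun a => (1 : ℚ) ⊗ₜ[ℚ] basisVec a
  counit_right := ext_basis (f := counitMap.lTensor _ ∘ₗ comulGlue)
    (g := (TensorProduct.mk ℚ FreeVincPerm ℚ).flip 1) fun z => by
    simp only [LinearMap.comp_apply, comulGlue_basisVec z, map_sum, LinearMap.lTensor_tmul,
      counitMap_basisVec, TensorProduct.mk_apply, TensorProduct.tmul_ite, LinearMap.flip_apply]
    exact z.sum_coverings_counit_right fun a => basisVec a ⊗ₜ[ℚ] (1 : ℚ)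
  counit_one := by rw [unitMap_one, counitMap_basisVec, if_pos rfl]
  counit_mul u v := by
    induction u using basis_induction with
    | zero => simp
    | add u u' hu hu' => simp only [map_add, LinearMap.add_apply, add_mul, hu, hu']
    | smul c u hu => simp only [map_smul, LinearMap.smul_apply, smul_mul_assoc, hu]
    | basis x =>
      induction v using basis_induction with
      | zero => simp
      | add v v' hv hv' => simp only [map_add, mul_add, hv, hv']
      | smul c v hv => simp only [map_smul, mul_smul_comm, hv]
      | basis y =>
        rw [mulConc_basisVec, counitMap_basisVec, counitMap_basisVec, counitMap_basisVec,
          VincPerm.conc_eq_empty_iff]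
        split_ifs <;> simp_all
  comul_one := by
    have hC : IsSubpath VincPerm.empty.cells := isSubpath_cellsOf _
    have he : VincPerm.empty.cells = ∅ := rfl
    -- The empty graph has a single covering, by two empty subgraphs.
    have hcov : coverings VincPerm.empty.cells = {(VincPerm.empty.cells, ∅)} := by
      ext p
      rw [Finset.mem_singleton, ← VincPerm.coverings_empty_right hC, iff_self_and]
      intro hp
      have h3 := (mem_coverings.mp hp).2.2
      rw [he, Finset.union_eq_empty] at h3
      exact h3.2
    rw [unitMap_one, comulGlue_basisVec, hcov, Finset.sum_singleton, VincPerm.res_cells, ← he,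
      VincPerm.res_cells]
  comul_mul u v := by
    induction u using basis_induction with
    | zero => simp
    | add u u' hu hu' => simp only [map_add, LinearMap.add_apply, hu, hu']
    | smul c u hu => simp only [map_smul, LinearMap.smul_apply, hu]
    | basis x =>
      induction v using basis_induction with
      | zero => simp
      | add v v' hv hv' => simp only [map_add, hv, hv']
      | smul c v hv => simp only [map_smul, hv]
      | basis y =>
        rw [mulConc_basisVec, comulGlue_basisVec,
          VincPerm.sum_coverings_conc x y fun a b => basisVec a ⊗ₜ[ℚ] basisVec b,
          comulGlue_basisVec x, comulGlue_basisVec y]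
        simp only [map_sum, LinearMap.sum_apply, TensorProduct.map₂_apply_tmul,
          TensorProduct.map_tmul, mulConc_basisVec]
        rw [Finset.sum_comm]

/-! ### The dual bialgebra -/

/-- The pairing for which the basis of vincular permutations is orthonormal. -/
def dualPairing : FreeVincPerm →ₗ[ℚ] FreeVincPerm →ₗ[ℚ] ℚ :=
  Finsupp.linearCombination ℚ fun x => Finsupp.lapply x

open Classical in
theorem dualPairing_basisVec (x y : VincPerm) :
    dualPairing (basisVec x) (basisVec y) = if x = y then 1 else 0 := by
  simp [dualPairing, Finsupp.single_apply, eq_comm]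

open Classical in
theorem dualPairing_basisVec' (x y : VincPerm) :
    dualPairing (basisVec x) (basisVec y) = if y = x then 1 else 0 := by
  rw [dualPairing_basisVec]
  exact if_congr eq_comm rfl rfl

open Classical in
theorem dualPairing_right (v : FreeVincPerm) (y : VincPerm) :
    dualPairing v (basisVec y) = v y := by
  refine ext_basis (f := dualPairing.flip (basisVec y)) (g := Finsupp.lapply y) (fun x => ?_) v
  rw [LinearMap.flip_apply, dualPairing_basisVec, Finsupp.lapply_apply, Finsupp.single_apply]

theorem mulGlue_basisVec_apply (x y z : VincPerm) :
    mulGlue (basisVec x) (basisVec y) z = glueCoeff x y z := by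
  simp only [mulGlue, Finsupp.linearCombination_single, one_smul]
  rfl

/-- Pairing with basis vectors reads off coefficients, so the gluing product is adjoint to the
gluing coproduct and deconcatenation to concatenation; duality does the rest. -/
theorem bialgebraAxioms_glue :
    BialgebraAxioms mulGlue comulDeconc unitMap counitMap := by
  refine bialgebraAxioms_conc.dual (B := dualPairing) (b := Finsupp.basisSingleOne) ?_ ?_ ?_ ?_ ?_
  · intro v i
    rw [Finsupp.coe_basisSingleOne]
    exact dualPairing_right v i
  · intro u v w
    induction w using basis_induction with
    | zero => simp
    | add w w' hw hw' => simp only [map_add, hw, hw']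
    | smul c w hw => simp only [map_smul, hw]
    | basis z =>
      induction u using basis_induction with
      | zero => simp
      | add u u' hu hu' => simp only [map_add, LinearMap.add_apply, TensorProduct.add_tmul, hu, hu']
      | smul c u hu => simp only [map_smul, LinearMap.smul_apply, ← TensorProduct.smul_tmul', hu]
      | basis x =>
        induction v using basis_induction with
        | zero => simp
        | add v v' hv hv' =>
          simp only [map_add, LinearMap.add_apply, TensorProduct.tmul_add, hv, hv']
        | smul c v hv => simp only [map_smul, LinearMap.smul_apply, TensorProduct.tmul_smul, hv]
        | basis y =>
          rw [dualPairing_right, mulGlue_basisVec_apply, glueCoeff_eq, comulGlue_basisVec, map_sum]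
          refine Finset.sum_congr rfl fun p _ => ?_
          rw [tensorPairing_tmul, dualPairing_basisVec', dualPairing_basisVec']
          simp only [ite_and, ite_mul, one_mul, zero_mul]
  · intro w u v
    induction u using basis_induction with
    | zero => simp
    | add u u' hu hu' => simp only [map_add, LinearMap.add_apply, TensorProduct.add_tmul, hu, hu']
    | smul c u hu =>
      simp only [map_smul, LinearMap.smul_apply, ← TensorProduct.smul_tmul', hu]
    | basis x =>
      induction v using basis_induction with
      | zero => simp
      | add v v' hv hv' => simp only [map_add, TensorProduct.tmul_add, hv, hv']
      | smul c v hv => simp only [map_smul, TensorProduct.tmul_smul, hv]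
      | basis y =>
        refine ext_basis
          (f := (tensorPairing dualPairing dualPairing).flip (basisVec x ⊗ₜ basisVec y) ∘ₗ
            comulDeconc)
          (g := dualPairing.flip (mulConc (basisVec x) (basisVec y))) (fun z => ?_) w
        classical
        rw [LinearMap.comp_apply, LinearMap.flip_apply, LinearMap.flip_apply, mulConc_basisVec,
          dualPairing_basisVec, comulDeconc_basisVec, map_sum, LinearMap.sum_apply]
        have hterm : ∀ p : VincPerm × VincPerm, tensorPairing dualPairing dualPairing
            (basisVec p.1 ⊗ₜ basisVec p.2) (basisVec x ⊗ₜ basisVec y) =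
              if p = (x, y) then 1 else 0 := fun p => by
          rw [tensorPairing_tmul, dualPairing_basisVec, dualPairing_basisVec]
          simp only [Prod.ext_iff, ite_and, ite_mul, one_mul, zero_mul]
        -- Only the factorization `(x, y)` contributes, and it occurs exactly when `x.conc y = z`.
        simp only [hterm, Finset.sum_ite_eq', Set.Finite.mem_toFinset, Set.mem_ofPred_eq, eq_comm]
  · refine fun v => ext_basis (f := dualPairing (unitMap 1)) (g := counitMap) (fun x => ?_) v
    rw [unitMap_one, dualPairing_basisVec', counitMap_basisVec]
  · intro v
    rw [unitMap_one, dualPairing_right]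
    rfl

/-! ### The antipode and the filtration by size -/

namespace VincPerm

theorem mem_factors {z : VincPerm} {p : VincPerm × VincPerm} :
    p ∈ z.finite_conc_eq.toFinset ↔ p.1.conc p.2 = z := by
  simp

theorem size_add_of_conc_eq {x y z : VincPerm} (h : x.conc y = z) : x.size + y.size = z.size :=
  congrArg size h

theorem size_pos {x : VincPerm} (h : x ≠ empty) : 0 < x.size :=
  Nat.pos_of_ne_zero fun hs => h (eq_empty_of_size hs)

end VincPerm

open Classical in
/-- The factorizations of `z` with non-empty right factor. -/
def properLeft (z : VincPerm) : Finset (VincPerm × VincPerm) :=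
  z.finite_conc_eq.toFinset.filter fun p => p.2 ≠ VincPerm.empty

open Classical in
/-- The factorizations of `z` with non-empty left factor. -/
def properRight (z : VincPerm) : Finset (VincPerm × VincPerm) :=
  z.finite_conc_eq.toFinset.filter fun p => p.1 ≠ VincPerm.empty

theorem mem_properLeft {z : VincPerm} {p : VincPerm × VincPerm} :
    p ∈ properLeft z ↔ p.1.conc p.2 = z ∧ p.2 ≠ VincPerm.empty := by
  simp [properLeft]

theorem mem_properRight {z : VincPerm} {p : VincPerm × VincPerm} :
    p ∈ properRight z ↔ p.1.conc p.2 = z ∧ p.1 ≠ VincPerm.empty := by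
  simp [properRight]

theorem size_lt_of_mem_properLeft {z : VincPerm} {p : VincPerm × VincPerm}
    (h : p ∈ properLeft z) : p.1.size < z.size := by
  obtain ⟨h1, h2⟩ := mem_properLeft.mp h
  have := VincPerm.size_add_of_conc_eq h1
  have := VincPerm.size_pos h2
  omega

theorem size_lt_of_mem_properRight {z : VincPerm} {p : VincPerm × VincPerm}
    (h : p ∈ properRight z) : p.2.size < z.size := by
  obtain ⟨h1, h2⟩ := mem_properRight.mp h
  have := VincPerm.size_add_of_conc_eq h1
  have := VincPerm.size_pos h2
  omega

/-- The left convolution inverse of the identity, on basis elements. -/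
def leftAntipode (z : VincPerm) : FreeVincPerm :=
  unitMap (counitMap (basisVec z)) -
    ∑ p : properLeft z, mulGlue (leftAntipode p.1.1) (basisVec p.1.2)
termination_by z.size
decreasing_by exact size_lt_of_mem_properLeft p.2

/-- The right convolution inverse of the identity, on basis elements. -/
def rightAntipode (z : VincPerm) : FreeVincPerm :=
  unitMap (counitMap (basisVec z)) -
    ∑ p : properRight z, mulGlue (basisVec p.1.1) (rightAntipode p.1.2)
termination_by z.size
decreasing_by exact size_lt_of_mem_properRight p.2

theorem leftAntipode_eq (z : VincPerm) : leftAntipode z = unitMap (counitMap (basisVec z)) -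
    ∑ p ∈ properLeft z, mulGlue (leftAntipode p.1) (basisVec p.2) := by
  rw [leftAntipode, Finset.sum_coe_sort (properLeft z)
    fun p => mulGlue (leftAntipode p.1) (basisVec p.2)]

theorem rightAntipode_eq (z : VincPerm) : rightAntipode z = unitMap (counitMap (basisVec z)) -
    ∑ p ∈ properRight z, mulGlue (basisVec p.1) (rightAntipode p.2) := by
  rw [rightAntipode, Finset.sum_coe_sort (properRight z)
    fun p => mulGlue (basisVec p.1) (rightAntipode p.2)]

open Classical in
-- The pair `(z, empty)` is the only factorization with empty right factor. Its term in the left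
-- convolution equation is the unknown value at `z`; all others involve smaller left factors.
theorem sum_factors_left {M : Type*} [AddCommGroup M] (z : VincPerm)
    (f : VincPerm × VincPerm → M) : ∑ p ∈ z.finite_conc_eq.toFinset, f p =
      f (z, VincPerm.empty) + ∑ p ∈ properLeft z, f p := by
  rw [← Finset.sum_filter_not_add_sum_filter (z.finite_conc_eq.toFinset)
    (fun p => p.2 ≠ VincPerm.empty), properLeft]
  congr 1
  refine Finset.sum_eq_single_of_mem _ ?_ ?_ |>.trans rfl
  · exact Finset.mem_filter.mpr ⟨VincPerm.mem_factors.mpr z.conc_empty, by simp⟩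
  · rintro ⟨x, y⟩ hp hne
    obtain ⟨h1, h2⟩ := Finset.mem_filter.mp hp
    obtain rfl : y = VincPerm.empty := not_not.mp h2
    rw [VincPerm.mem_factors, VincPerm.conc_empty] at h1
    exact absurd (congrArg (·, VincPerm.empty) h1) hne

open Classical in
theorem sum_factors_right {M : Type*} [AddCommGroup M] (z : VincPerm)
    (f : VincPerm × VincPerm → M) : ∑ p ∈ z.finite_conc_eq.toFinset, f p =
      f (VincPerm.empty, z) + ∑ p ∈ properRight z, f p := by
  rw [← Finset.sum_filter_not_add_sum_filter (z.finite_conc_eq.toFinset)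
    (fun p => p.1 ≠ VincPerm.empty), properRight]
  congr 1
  refine Finset.sum_eq_single_of_mem _ ?_ ?_ |>.trans rfl
  · exact Finset.mem_filter.mpr ⟨VincPerm.mem_factors.mpr z.empty_conc, by simp⟩
  · rintro ⟨x, y⟩ hp hne
    obtain ⟨h1, h2⟩ := Finset.mem_filter.mp hp
    obtain rfl : x = VincPerm.empty := not_not.mp h2
    rw [VincPerm.mem_factors, VincPerm.empty_conc] at h1
    exact absurd (congrArg (VincPerm.empty, ·) h1) hne

/-- The antipode. -/
def antipodeGlue : FreeVincPerm →ₗ[ℚ] FreeVincPerm :=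
  Finsupp.linearCombination ℚ leftAntipode

theorem antipodeGlue_basisVec (x : VincPerm) : antipodeGlue (basisVec x) = leftAntipode x := by
  simp [antipodeGlue]

/-- After the trivial factorization is split off, the recursions defining `leftAntipode` and
`rightAntipode` are precisely the two convolution equations. -/
theorem isHopfAlgebra_glue :
    IsHopfAlgebra mulGlue comulDeconc unitMap counitMap antipodeGlue := by
  refine bialgebraAxioms_glue.isHopfAlgebra (T := Finsupp.linearCombination ℚ rightAntipode)
    ?_ ?_
  · refine ext_basis (f := TensorProduct.lift mulGlue ∘ₗ antipodeGlue.rTensor _ ∘ₗ comulDeconc)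
      (g := unitMap ∘ₗ counitMap) fun z => ?_
    simp only [LinearMap.comp_apply, comulDeconc_basisVec, map_sum, LinearMap.rTensor_tmul,
      TensorProduct.lift.tmul, antipodeGlue_basisVec]
    rw [sum_factors_left, ← unitMap_one, bialgebraAxioms_glue.mul_one, leftAntipode_eq z,
      sub_add_cancel]
  · refine ext_basis (f := TensorProduct.lift mulGlue ∘ₗ
      (Finsupp.linearCombination ℚ rightAntipode).lTensor _ ∘ₗ comulDeconc)
      (g := unitMap ∘ₗ counitMap) fun z => ?_
    simp only [LinearMap.comp_apply, comulDeconc_basisVec, map_sum, LinearMap.lTensor_tmul,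
      TensorProduct.lift.tmul, Finsupp.linearCombination_single, one_smul]
    rw [sum_factors_right, ← unitMap_one, bialgebraAxioms_glue.one_mul, rightAntipode_eq z,
      sub_add_cancel]

/-! ### The filtration by size -/

theorem basisVec_mem {x : VincPerm} {n : ℕ} (h : x.size ≤ n) : basisVec x ∈ sizeFiltration n :=
  Submodule.subset_span ⟨x, h, rfl⟩

theorem sizeFiltration_mono : Monotone sizeFiltration := by
  intro m n hmn
  refine Submodule.span_mono ?_
  rintro v ⟨x, hx, rfl⟩
  exact ⟨x, hx.trans hmn, rfl⟩

theorem sizeFiltration_eq_supported (n : ℕ) :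
    sizeFiltration n = Finsupp.supported ℚ ℚ {x : VincPerm | x.size ≤ n} := by
  rw [Finsupp.supported_eq_span_single, sizeFiltration]
  congr 1
  ext v
  simp only [Set.mem_image, Set.mem_ofPred_eq, eq_comm]

theorem sizeFiltration_induction {n : ℕ} {p : FreeVincPerm → Prop} {v : FreeVincPerm}
    (hv : v ∈ sizeFiltration n) (basis : ∀ x : VincPerm, x.size ≤ n → p (basisVec x)) (zero : p 0)
    (add : ∀ v w, p v → p w → p (v + w)) (smul : ∀ (c : ℚ) v, p v → p (c • v)) : p v := by
  refine Submodule.span_induction (p := fun v _ => p v) ?_ zero (fun v w _ _ => add v w)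
    (fun c v _ => smul c v) hv
  rintro v ⟨x, hx, rfl⟩
  exact basis x hx

theorem glueCoeff_eq_zero {x y z : VincPerm} (h : x.size + y.size < z.size) :
    glueCoeff x y z = 0 := by
  classical
  rw [glueCoeff]
  refine Finset.sum_eq_zero fun A _ => Finset.sum_eq_zero fun A' _ => ?_
  split_ifs with hA
  · refine Finset.sum_eq_zero fun I _ => Finset.sum_eq_zero fun I' _ => if_neg ?_
    rintro ⟨-, rfl, rfl⟩
    have h' := Finset.card_union_le A A'
    rw [hA, Finset.card_univ, Fintype.card_fin] at h'
    exact absurd h (not_lt.mpr h')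
  · rfl

/-- The sets `A` and `A'` may overlap, so terms of smaller size than the sum can occur; the product
respects the filtration through the upper bound on sizes in `glueCoeff_eq_zero`. -/
theorem mulGlue_mem {p q : ℕ} {v w : FreeVincPerm} (hv : v ∈ sizeFiltration p)
    (hw : w ∈ sizeFiltration q) : mulGlue v w ∈ sizeFiltration (p + q) := by
  refine sizeFiltration_induction (p := fun v => mulGlue v w ∈ _) hv (fun x hx => ?_) (by simp)
    (fun v v' h h' => ?_) (fun c v h => ?_)
  · refine sizeFiltration_induction (p := fun w => mulGlue _ w ∈ _) hw (fun y hy => ?_) (by simp)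
      (fun w w' h h' => ?_) (fun c w h => ?_)
    · rw [sizeFiltration_eq_supported, Finsupp.mem_supported']
      intro z hz
      rw [mulGlue_basisVec_apply]
      refine glueCoeff_eq_zero ?_
      simp only [Set.mem_ofPred_eq, not_le] at hz
      omega
    · rw [map_add]
      exact Submodule.add_mem _ h h'
    · rw [map_smul]
      exact Submodule.smul_mem _ _ h
  · rw [map_add, LinearMap.add_apply]
    exact Submodule.add_mem _ h h'
  · rw [map_smul, LinearMap.smul_apply]
    exact Submodule.smul_mem _ _ h

theorem unitMap_one_mem : unitMap 1 ∈ sizeFiltration 0 := basisVec_mem le_rfl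

theorem leftAntipode_mem (n : ℕ) : ∀ z : VincPerm, z.size ≤ n →
    leftAntipode z ∈ sizeFiltration n := by
  induction n using Nat.strong_induction_on with
  | h n ih =>
    intro z hz
    rw [leftAntipode_eq]
    refine Submodule.sub_mem _ ?_ (Submodule.sum_mem _ fun p hp => ?_)
    -- The first term of the recursion is a multiple of the unit, hence already in degree zero.
    · rw [← mul_one (counitMap _), ← smul_eq_mul, map_smul]
      exact Submodule.smul_mem _ _ (sizeFiltration_mono (Nat.zero_le n) unitMap_one_mem)
    · have hlt := size_lt_of_mem_properLeft hp
      have hadd := VincPerm.size_add_of_conc_eq (mem_properLeft.mp hp).1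
      refine sizeFiltration_mono (?_ : p.1.size + p.2.size ≤ n)
        (mulGlue_mem (ih _ (by omega) _ le_rfl) (basisVec_mem le_rfl))
      omega

theorem comulDeconc_mem (n : ℕ) (v : FreeVincPerm) (hv : v ∈ sizeFiltration n) :
    comulDeconc v ∈ ⨆ (p : ℕ) (q : ℕ) (_ : p + q = n),
      LinearMap.range (TensorProduct.map (sizeFiltration p).subtype
        (sizeFiltration q).subtype) := by
  refine sizeFiltration_induction (p := fun v => comulDeconc v ∈ _) hv (fun z hz => ?_) (by simp)
    (fun v v' h h' => ?_) (fun c v h => ?_)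
  · rw [comulDeconc_basisVec]
    refine Submodule.sum_mem _ fun p hp => ?_
    have hadd := VincPerm.size_add_of_conc_eq (VincPerm.mem_factors.mp hp)
    -- The size of `z` may be less than `n`; the slack is given to the right index so that the two
    -- indices add up to exactly `n`.
    refine Submodule.mem_iSup_of_mem p.1.size (Submodule.mem_iSup_of_mem (n - p.1.size)
      (Submodule.mem_iSup_of_mem (by omega) ?_))
    exact ⟨⟨basisVec p.1, basisVec_mem le_rfl⟩ ⊗ₜ ⟨basisVec p.2, basisVec_mem (by omega)⟩, rfl⟩
  · rw [map_add]
    exact Submodule.add_mem _ h h'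
  · rw [map_smul]
    exact Submodule.smul_mem _ _ h

theorem isConnectedHopfFiltration_size :
    IsConnectedHopfFiltration mulGlue comulDeconc unitMap antipodeGlue sizeFiltration where
  mono := sizeFiltration_mono
  exhaustive := by
    refine eq_top_iff.mpr fun v _ => ?_
    induction v using basis_induction with
    | zero => exact Submodule.zero_mem _
    | add v w hv hw => exact Submodule.add_mem _ (hv trivial) (hw trivial)
    | smul c v hv => exact Submodule.smul_mem _ _ (hv trivial)
    | basis x => exact Submodule.mem_iSup_of_mem x.size (basisVec_mem le_rfl)
  unit_mem := unitMap_one_mem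
  mul_mem _ _ _ hx _ hy := mulGlue_mem hx hy
  comul_mem := comulDeconc_mem
  antipode_mem n v hv := by
    refine sizeFiltration_induction (p := fun v => antipodeGlue v ∈ _) hv (fun z hz => ?_) (by simp)
      (fun v v' h h' => ?_) (fun c v h => ?_)
    · rw [antipodeGlue_basisVec]
      exact leftAntipode_mem n z hz
    · rw [map_add]
      exact Submodule.add_mem _ h h'
    · rw [map_smul]
      exact Submodule.smul_mem _ _ h
  connected := by
    have h : sizeFiltration 0 = Submodule.span ℚ {basisVec VincPerm.empty} := by
      rw [sizeFiltration]
      congr 1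
      ext v
      constructor
      · rintro ⟨x, hx, rfl⟩
        rw [VincPerm.eq_empty_of_size (Nat.le_zero.mp hx)]
        rfl
      · rintro rfl
        exact ⟨_, le_rfl, rfl⟩
    rw [h]
    exact finrank_span_singleton (by simp)

end VincularHopf

end

theorem mainTheorem4 :
    VincularHopf.IsBialgebra VincularHopf.mulConc VincularHopf.comulGlue
      VincularHopf.unitMap VincularHopf.counitMap ∧
    VincularHopf.IsConnectedFilteredHopfAlgebra VincularHopf.mulGlue VincularHopf.comulDeconc
      VincularHopf.unitMap VincularHopf.counitMap VincularHopf.sizeFiltration :=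
  ⟨VincularHopf.bialgebraAxioms_conc.isBialgebra,
    VincularHopf.antipodeGlue, VincularHopf.isHopfAlgebra_glue,
    VincularHopf.isConnectedHopfFiltration_size⟩
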